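/- Fermionic Contraction Formula. Let $(X,\mu)$ be $\mathbb N$ with counting measure or $\mathbb R^d$ with Lebesgue measure (more generally, any $\sigma$-finite measure space), $\mathfrak h=L^2(X,\mu)$, $\mathscr F_-=\bigoplus_{N\ge 0}S_-\mathfrak h^{\otimes N}$ the fermionic Fock space ($S_-$ the antisymmetrization), and $\mathscr F_{\rm fin}\subset\mathscr F_-$ the subspace of vectors with finitely many non-zero sectors. On $\mathscr F_{\rm fin}$ let $a^*(f)\Psi^{(N)}=\sqrt{N+1}\,S_-(f\otimes\Psi^{(N)})$ and let $a(f)$ be the adjoint of $a^*(f)$. For $n,m\in\mathbb N_0$ and $f\in\mathfrak h^{\otimes n}\otimes\mathfrak h^{\otimes m}=L^2(X^{n}\times X^{m})$ let $$D^{(n,m)}(f)=\int f(x_1,\dots,x_n,y_1,\dots,y_m)\,a^*_{x_n}\cdots a^*_{x_1}a_{y_1}\cdots a_{y_m}\,dx\,dy$$ be the operator on $\mathscr F_{\rm fin}$ that is linear in $f$, continuous in $f$ on each sector, and satisfies $D^{(n,m)}(f_1\otimes\dots\otimes f_n\otimes\overline{g_1}\otimes\dots\otimes\overline{g_m})=a^*(f_n)\cdots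 a^*(f_1)a(g_1)\cdots a(g_m)$. Let $n_A,m_A,n_B,m_B\in\mathbb N_0$, $f_A\in L^2(X^{n_A}\times X^{m_A})$, $f_B\in L^2(X^{n_B}\times X^{m_B})$, $A=D^{(n_A,m_A)}(f_A)$ and $B=D^{(n_B,m_B)}(f_B)$. Write $a_{A,\ell}$, $a_{B,\ell}$ for the pointwise operators at the coordinates of $f_A$, $f_B$. The normal ordered product is $$:\!AB\!:\;=\int f_A f_B\Big(\prod_{\ell=1}^{n_A}a_{A,\ell}\Big)^{*}\Big(\prod_{\ell=1}^{n_B}a_{B,\ell}\Big)^{*}\prod_{\ell=1}^{m_A}a_{A,\ell}\prod_{\ell=1}^{m_B}a_{B,\ell}\,dX\,dY .$$ Let $\mathcal C$ be the set of all pairs $(\pi,\pi')$ with $1\le C\le\min(m_A,n_B)$, $\pi:\{1,\dots,C\}\to\{1,\dots,n_B\}$ strictly decreasing and $\pi':\{1,\dots,C\}\to\{1,\dots,m_A\}$ injective. Let $\mathcal U,\mathcal U'$ be the complements of the images of $\pi,\pi'$. Let $\sigma,\sigma'$ be the unique permutations of $\{1,\dots,n_B\}$, $\{1,\dots,m_A\}$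 with $\sigma(\pi(c))=n_B-c+1$ and $\sigma'(\pi'(c))=m_A-c+1$ for all $c$ that are increasing on $\mathcal U$, $\mathcal U'$ respectively, and put $\mathrm{sgn}(\pi,\pi')=(-1)^{(m_A-C)(n_B-C)}\,\mathrm{sgn}(\sigma)\,\mathrm{sgn}(\sigma')$. The fermionic attached product is $$A\circ_F B=\sum_{(\pi,\pi')\in\mathcal C}\mathrm{sgn}(\pi,\pi')\int f_A f_B\prod_{c=1}^{C}\delta(x_{B,\pi(c)}-y_{A,\pi'(c)})\Big(\prod_{\ell=1}^{n_A}a_{A,\ell}\Big)^{*}\Big(\prod_{u\in\mathcal U}a_{B,u}\Big)^{*}\prod_{u'\in\mathcal U'}a_{A,u'}\prod_{\ell=1}^{m_B}a_{B,\ell}\,dX\,dY,$$ with products over sets taken in increasing order, and each summand understood as $D^{(n,m)}$, where $n=n_A+n_B-C$ and $m=m_A+m_B-C$, applied to the $L^2$-kernel obtained by identifying and integrating out the $C$ pairs of contracted coordinates. Then, as operators on $\mathscr F_{\rm fin}$, $$AB=(-1)^{m_A n_B}\,:\!AB\!:\;+\;A\circ_F B .$$ -/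

import Mathlib

open MeasureTheory
open scoped ENNReal

set_option linter.unusedSectionVars false

namespace Friedrichs

theorem eLpNorm_two_sq {α : Type*} [MeasurableSpace α] (μ : Measure α) (f : α → ℂ) :
    eLpNorm f 2 μ ^ 2 = ∫⁻ a, ‖f a‖ₑ ^ 2 ∂μ := by
  rw [eLpNorm_eq_lintegral_rpow_enorm_toReal (by norm_num) (by norm_num)]
  simp only [ENNReal.toReal_ofNat, ENNReal.rpow_ofNat, one_div]
  rw [← ENNReal.rpow_natCast, ← ENNReal.rpow_mul]
  norm_num

section Kernel

variable {α β γ : Type*} [MeasurableSpace α] [MeasurableSpace β] [MeasurableSpace γ]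
  {μ : Measure α} {ν : Measure β} {ρ : Measure γ} [SFinite μ] [SFinite ν] [SFinite ρ]

/-- The partial pairing of two functions over the shared variable. -/
noncomputable def pairFun (ν : Measure β) (F : α × β → ℂ) (G : β × γ → ℂ) (p : α × γ) : ℂ :=
  ∫ y, F (p.1, y) * G (y, p.2) ∂ν

theorem section_left {F : α × β → ℂ} (hF : MemLp F 2 (μ.prod ν)) :
    ∀ᵐ a ∂μ, MemLp (fun b => F (a, b)) 2 ν := by
  have h1 := hF.integrable_norm_pow (by norm_num)
  have h2 := h1.prod_right_ae
  have h3 := hF.1.prodMk_left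
  filter_upwards [h2, h3] with a ha hb
  exact (memLp_two_iff_integrable_sq_norm hb).2 (by simpa using ha)

theorem section_right {G : β × γ → ℂ} (hG : MemLp G 2 (ν.prod ρ)) :
    ∀ᵐ c ∂ρ, MemLp (fun b => G (b, c)) 2 ν :=
  section_left (hG.comp_measurePreserving (Measure.measurePreserving_swap (μ := ρ) (ν := ν)))

theorem pair_integrable {F : α × β → ℂ} {G : β × γ → ℂ} (hF : MemLp F 2 (μ.prod ν))
    (hG : MemLp G 2 (ν.prod ρ)) :
    ∀ᵐ p ∂(μ.prod ρ), Integrable (fun y => F (p.1, y) * G (y, p.2)) ν := by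
  have h1 : ∀ᵐ p ∂(μ.prod ρ), MemLp (fun b => F (p.1, b)) 2 ν :=
    Measure.quasiMeasurePreserving_fst.ae (section_left hF)
  have h2 : ∀ᵐ p ∂(μ.prod ρ), MemLp (fun b => G (b, p.2)) 2 ν :=
    Measure.quasiMeasurePreserving_snd.ae (section_right hG)
  filter_upwards [h1, h2] with p hp hq
  exact hp.integrable_mul hq

theorem pair_congr {F F' : α × β → ℂ} {G G' : β × γ → ℂ} (hF : F =ᵐ[μ.prod ν] F')
    (hG : G =ᵐ[ν.prod ρ] G') : pairFun ν F G =ᵐ[μ.prod ρ] pairFun ν F' G' := by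
  have h1 : ∀ᵐ p ∂(μ.prod ρ), ∀ᵐ b ∂ν, F (p.1, b) = F' (p.1, b) :=
    Measure.quasiMeasurePreserving_fst.ae (Measure.ae_ae_of_ae_prod hF)
  have hG' : ∀ᵐ q ∂(ρ.prod ν), G q.swap = G' q.swap :=
    (Measure.measurePreserving_swap (μ := ρ) (ν := ν)).quasiMeasurePreserving.ae hG
  have h2 : ∀ᵐ p ∂(μ.prod ρ), ∀ᵐ b ∂ν, G (b, p.2) = G' (b, p.2) :=
    Measure.quasiMeasurePreserving_snd.ae (Measure.ae_ae_of_ae_prod hG')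
  filter_upwards [h1, h2] with p hp hq
  refine integral_congr_ae ?_
  filter_upwards [hp, hq] with b h h'
  rw [h, h']

theorem pair_aesm {F : α × β → ℂ} {G : β × γ → ℂ} (hF : AEStronglyMeasurable F (μ.prod ν))
    (hG : AEStronglyMeasurable G (ν.prod ρ)) :
    AEStronglyMeasurable (pairFun ν F G) (μ.prod ρ) := by
  refine AEStronglyMeasurable.congr ?_ (pair_congr hF.ae_eq_mk hG.ae_eq_mk).symm
  have h1 : StronglyMeasurable (fun q : (α × γ) × β => hF.mk F (q.1.1, q.2)) :=
    hF.stronglyMeasurable_mk.comp_measurable (by fun_prop)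
  have h2 : StronglyMeasurable (fun q : (α × γ) × β => hG.mk G (q.2, q.1.2)) :=
    hG.stronglyMeasurable_mk.comp_measurable (by fun_prop)
  exact ((h1.mul h2).integral_prod_right (ν := ν)).aestronglyMeasurable

theorem pair_eLpNorm_le {F : α × β → ℂ} {G : β × γ → ℂ}
    (hF : AEStronglyMeasurable F (μ.prod ν)) (hG : AEStronglyMeasurable G (ν.prod ρ)) :
    eLpNorm (pairFun ν F G) 2 (μ.prod ρ) ≤ eLpNorm F 2 (μ.prod ν) * eLpNorm G 2 (ν.prod ρ) := by
  wlog h : StronglyMeasurable F ∧ StronglyMeasurable G generalizing F G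
  · rw [eLpNorm_congr_ae (pair_congr hF.ae_eq_mk hG.ae_eq_mk), eLpNorm_congr_ae hF.ae_eq_mk,
      eLpNorm_congr_ae hG.ae_eq_mk]
    exact this hF.stronglyMeasurable_mk.aestronglyMeasurable
      hG.stronglyMeasurable_mk.aestronglyMeasurable
      ⟨hF.stronglyMeasurable_mk, hG.stronglyMeasurable_mk⟩
  obtain ⟨hF', hG'⟩ := h
  have mF : Measurable (fun q : α × β => ‖F q‖ₑ ^ 2) := by
    have := hF'.measurable
    fun_prop
  have mG : Measurable (fun q : β × γ => ‖G q‖ₑ ^ 2) := by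
    have := hG'.measurable
    fun_prop
  have key : ∀ p : α × γ, ‖pairFun ν F G p‖ₑ ^ 2 ≤
      (∫⁻ b, ‖F (p.1, b)‖ₑ ^ 2 ∂ν) * (∫⁻ b, ‖G (b, p.2)‖ₑ ^ 2 ∂ν) := by
    intro p
    have h1 : ‖pairFun ν F G p‖ₑ ≤ eLpNorm (fun b => F (p.1, b)) 2 ν *
        eLpNorm (fun b => G (b, p.2)) 2 ν := by
      refine (enorm_integral_le_lintegral_enorm _).trans ?_
      have := eLpNorm_smul_le_mul_eLpNorm (p := 2) (q := 2) (r := 1) (μ := ν)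
        (f := fun b => G (b, p.2)) (φ := fun b => F (p.1, b))
        (hG'.comp_measurable (by fun_prop)).aestronglyMeasurable
        (hF'.comp_measurable (by fun_prop)).aestronglyMeasurable
      rw [eLpNorm_one_eq_lintegral_enorm] at this
      simpa using this
    calc ‖pairFun ν F G p‖ₑ ^ 2 ≤ _ := pow_le_pow_left' h1 2
      _ = _ := by rw [mul_pow, eLpNorm_two_sq, eLpNorm_two_sq]
  have hsq : eLpNorm (pairFun ν F G) 2 (μ.prod ρ) ^ 2 ≤
      (eLpNorm F 2 (μ.prod ν) * eLpNorm G 2 (ν.prod ρ)) ^ 2 := by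
    rw [mul_pow, eLpNorm_two_sq, eLpNorm_two_sq, eLpNorm_two_sq]
    calc ∫⁻ p, ‖pairFun ν F G p‖ₑ ^ 2 ∂(μ.prod ρ) ≤ _ := lintegral_mono key
      _ = (∫⁻ a, ∫⁻ b, ‖F (a, b)‖ₑ ^ 2 ∂ν ∂μ) * ∫⁻ c, ∫⁻ b, ‖G (b, c)‖ₑ ^ 2 ∂ν ∂ρ :=
        lintegral_prod_mul mF.lintegral_prod_right'.aemeasurable
          mG.lintegral_prod_left'.aemeasurable
      _ = _ := by
        rw [lintegral_prod _ mF.aemeasurable, lintegral_prod_symm _ mG.aemeasurable]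
  exact (ENNReal.pow_le_pow_left_iff (by norm_num)).1 hsq

theorem pair_memLp {F : α × β → ℂ} {G : β × γ → ℂ} (hF : MemLp F 2 (μ.prod ν))
    (hG : MemLp G 2 (ν.prod ρ)) : MemLp (pairFun ν F G) 2 (μ.prod ρ) :=
  ⟨pair_aesm hF.1 hG.1, (pair_eLpNorm_le hF.1 hG.1).trans_lt (ENNReal.mul_lt_top hF.2 hG.2)⟩

end Kernel

section Tensor

variable {X : Type*} [MeasurableSpace X] (μ : Measure X) [SigmaFinite μ]
  {ι κ τ : Type*} [Fintype ι] [Fintype κ] [Fintype τ]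

/-- The one-particle space `𝔥 = L²(X, μ)`. -/
abbrev OneParticle : Type _ := Lp ℂ 2 μ

/-- The tensor power `𝔥^{⊗ι} = L²(X^ι, μ^ι)` over a finite index set `ι`. -/
abbrev Tens (ι : Type*) [Fintype ι] : Type _ := Lp ℂ 2 (Measure.pi fun _ : ι => μ)

theorem mp_relabel (e : ι ≃ κ) : MeasurePreserving (fun z : κ → X => z ∘ e)
    (Measure.pi fun _ => μ) (Measure.pi fun _ => μ) :=
  (measurePreserving_piCongrLeft (fun _ : κ => μ) e).symm

theorem mp_split : MeasurePreserving
    (fun w : ι ⊕ κ → X => (w ∘ Sum.inl, w ∘ Sum.inr)) (Measure.pi fun _ => μ)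
    ((Measure.pi fun _ => μ).prod (Measure.pi fun _ => μ)) :=
  measurePreserving_sumPiEquivProdPi (fun _ : ι ⊕ κ => μ)

theorem mp_join : MeasurePreserving
    (fun p : (ι → X) × (κ → X) => (Sum.elim p.1 p.2 : ι ⊕ κ → X))
    ((Measure.pi fun _ => μ).prod (Measure.pi fun _ => μ)) (Measure.pi fun _ => μ) := by
  convert measurePreserving_sumPiEquivProdPi_symm (fun _ : ι ⊕ κ => μ) using 1
  ext p (i | i) <;> rfl

variable {μ}

/-- Relabelling of coordinates along `e : ι ≃ κ`: `(relabel e f)(z) = f(z ∘ e)`. -/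
noncomputable def relabel (e : ι ≃ κ) : Tens μ ι →ₗᵢ[ℂ] Tens μ κ :=
  Lp.compMeasurePreservingₗᵢ ℂ (fun z : κ → X => z ∘ e) (mp_relabel μ e)

theorem relabel_coe (e : ι ≃ κ) (f : Tens μ ι) :
    relabel e f =ᵐ[Measure.pi fun _ => μ] fun z => f (z ∘ e) :=
  Lp.coeFn_compMeasurePreserving f (mp_relabel μ e)

/-- The contraction of two kernels over a block `κ` of shared coordinates:
`(x, z) ↦ ∫ f(x, y) g(y, z) dy`. -/
noncomputable def contractFun (f : Tens μ (ι ⊕ κ)) (g : Tens μ (κ ⊕ τ)) (w : ι ⊕ τ → X) : ℂ :=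
  ∫ y : κ → X, f (Sum.elim (w ∘ Sum.inl) y) * g (Sum.elim y (w ∘ Sum.inr))
    ∂(Measure.pi fun _ => μ)

theorem memLp_join (f : Tens μ (ι ⊕ κ)) :
    MemLp (fun p : (ι → X) × (κ → X) => f (Sum.elim p.1 p.2)) 2
      ((Measure.pi fun _ => μ).prod (Measure.pi fun _ => μ)) :=
  (Lp.memLp f).comp_measurePreserving (mp_join μ)

theorem contractFun_eq (f : Tens μ (ι ⊕ κ)) (g : Tens μ (κ ⊕ τ)) :
    contractFun f g = pairFun (Measure.pi fun _ => μ)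
      (fun p : (ι → X) × (κ → X) => f (Sum.elim p.1 p.2))
      (fun p : (κ → X) × (τ → X) => g (Sum.elim p.1 p.2)) ∘
      (fun w : ι ⊕ τ → X => (w ∘ Sum.inl, w ∘ Sum.inr)) := rfl

theorem contractFun_memLp (f : Tens μ (ι ⊕ κ)) (g : Tens μ (κ ⊕ τ)) :
    MemLp (contractFun f g) 2 (Measure.pi fun _ => μ) := by
  rw [contractFun_eq]
  exact (pair_memLp (memLp_join f) (memLp_join g)).comp_measurePreserving (mp_split μ)

theorem contractFun_integrable (f : Tens μ (ι ⊕ κ)) (g : Tens μ (κ ⊕ τ)) :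
    ∀ᵐ w : ι ⊕ τ → X ∂(Measure.pi fun _ => μ),
      Integrable (fun y : κ → X => f (Sum.elim (w ∘ Sum.inl) y) * g (Sum.elim y (w ∘ Sum.inr)))
        (Measure.pi fun _ => μ) :=
  (mp_split μ).quasiMeasurePreserving.ae (pair_integrable (memLp_join f) (memLp_join g))

theorem contractFun_eLpNorm_le (f : Tens μ (ι ⊕ κ)) (g : Tens μ (κ ⊕ τ)) :
    eLpNorm (contractFun f g) 2 (Measure.pi fun _ => μ) ≤
      eLpNorm f 2 (Measure.pi fun _ => μ) * eLpNorm g 2 (Measure.pi fun _ => μ) := by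
  rw [contractFun_eq, eLpNorm_comp_measurePreserving
    (pair_memLp (memLp_join f) (memLp_join g)).1 (mp_split μ)]
  refine (pair_eLpNorm_le (memLp_join f).1 (memLp_join g).1).trans_eq ?_
  rw [← eLpNorm_comp_measurePreserving (Lp.memLp f).1 (mp_join μ),
    ← eLpNorm_comp_measurePreserving (Lp.memLp g).1 (mp_join μ)]
  rfl

theorem contractFun_congr {F F' : (ι ⊕ κ → X) → ℂ} {G G' : (κ ⊕ τ → X) → ℂ}
    (hF : F =ᵐ[Measure.pi fun _ => μ] F') (hG : G =ᵐ[Measure.pi fun _ => μ] G') :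
    ∀ᵐ w : ι ⊕ τ → X ∂(Measure.pi fun _ => μ), ∀ᵐ y : κ → X ∂(Measure.pi fun _ => μ),
      F (Sum.elim (w ∘ Sum.inl) y) = F' (Sum.elim (w ∘ Sum.inl) y) ∧
      G (Sum.elim y (w ∘ Sum.inr)) = G' (Sum.elim y (w ∘ Sum.inr)) := by
  have hF1 := (mp_join μ).quasiMeasurePreserving.ae hF
  have hG1 := ((mp_join μ).comp (Measure.measurePreserving_swap
    (μ := Measure.pi fun _ : τ => μ) (ν := Measure.pi fun _ : κ => μ))).quasiMeasurePreserving.ae hG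
  have hF2 := Measure.ae_ae_of_ae_prod hF1
  have hG2 := Measure.ae_ae_of_ae_prod hG1
  have h1 := (mp_split (ι := ι) (κ := τ) μ).quasiMeasurePreserving.ae
    (Measure.quasiMeasurePreserving_fst.ae hF2)
  have h2 := (mp_split (ι := ι) (κ := τ) μ).quasiMeasurePreserving.ae
    (Measure.quasiMeasurePreserving_snd.ae hG2)
  filter_upwards [h1, h2] with w a b
  filter_upwards [a, b] with y c d using ⟨c, d⟩

/-- Contraction over the shared block `κ`, as a bounded bilinear map
`𝔥^{⊗(ι ⊕ κ)} × 𝔥^{⊗(κ ⊕ τ)} → 𝔥^{⊗(ι ⊕ τ)}`. -/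
noncomputable def contract : Tens μ (ι ⊕ κ) →L[ℂ] Tens μ (κ ⊕ τ) →L[ℂ] Tens μ (ι ⊕ τ) :=
  LinearMap.mkContinuous₂
    (LinearMap.mk₂ ℂ (fun f g => (contractFun_memLp f g).toLp (contractFun f g))
      (by
        intro f f' g
        refine Lp.ext ?_
        filter_upwards [(contractFun_memLp (f + f') g).coeFn_toLp,
          Lp.coeFn_add ((contractFun_memLp f g).toLp _) ((contractFun_memLp f' g).toLp _),
          (contractFun_memLp f g).coeFn_toLp, (contractFun_memLp f' g).coeFn_toLp,
          contractFun_integrable f g, contractFun_integrable f' g,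
          contractFun_congr (Lp.coeFn_add f f') (ae_eq_refl g)] with w h1 h2 h3 h4 h5 h6 h7
        rw [h1, h2, Pi.add_apply, h3, h4]
        unfold contractFun
        rw [← integral_add h5 h6]
        refine integral_congr_ae ?_
        filter_upwards [h7] with y hy
        rw [hy.1, Pi.add_apply, add_mul])
      (by
        intro c f g
        refine Lp.ext ?_
        filter_upwards [(contractFun_memLp (c • f) g).coeFn_toLp,
          Lp.coeFn_smul c ((contractFun_memLp f g).toLp _),
          (contractFun_memLp f g).coeFn_toLp,
          contractFun_congr (Lp.coeFn_smul c f) (ae_eq_refl g)] with w h1 h2 h3 h7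
        rw [h1, h2, Pi.smul_apply, h3]
        unfold contractFun
        rw [← integral_smul]
        refine integral_congr_ae ?_
        filter_upwards [h7] with y hy
        rw [hy.1, Pi.smul_apply, smul_mul_assoc])
      (by
        intro f g g'
        refine Lp.ext ?_
        filter_upwards [(contractFun_memLp f (g + g')).coeFn_toLp,
          Lp.coeFn_add ((contractFun_memLp f g).toLp _) ((contractFun_memLp f g').toLp _),
          (contractFun_memLp f g).coeFn_toLp, (contractFun_memLp f g').coeFn_toLp,
          contractFun_integrable f g, contractFun_integrable f g',
          contractFun_congr (ae_eq_refl f) (Lp.coeFn_add g g')] with w h1 h2 h3 h4 h5 h6 h7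
        rw [h1, h2, Pi.add_apply, h3, h4]
        unfold contractFun
        rw [← integral_add h5 h6]
        refine integral_congr_ae ?_
        filter_upwards [h7] with y hy
        rw [hy.2, Pi.add_apply, mul_add])
      (by
        intro c f g
        refine Lp.ext ?_
        filter_upwards [(contractFun_memLp f (c • g)).coeFn_toLp,
          Lp.coeFn_smul c ((contractFun_memLp f g).toLp _),
          (contractFun_memLp f g).coeFn_toLp,
          contractFun_congr (ae_eq_refl f) (Lp.coeFn_smul c g)] with w h1 h2 h3 h7
        rw [h1, h2, Pi.smul_apply, h3]
        unfold contractFun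
        rw [← integral_smul]
        refine integral_congr_ae ?_
        filter_upwards [h7] with y hy
        rw [hy.2, Pi.smul_apply, mul_smul_comm]))
    1 (by
      intro f g
      simp only [LinearMap.mk₂_apply, one_mul]
      rw [Lp.norm_toLp, Lp.norm_def, Lp.norm_def, ← ENNReal.toReal_mul]
      exact ENNReal.toReal_mono (ENNReal.mul_ne_top (Lp.eLpNorm_ne_top f) (Lp.eLpNorm_ne_top g))
        (contractFun_eLpNorm_le f g))

theorem contract_coe (f : Tens μ (ι ⊕ κ)) (g : Tens μ (κ ⊕ τ)) :
    contract f g =ᵐ[Measure.pi fun _ => μ] contractFun f g :=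
  (contractFun_memLp f g).coeFn_toLp

theorem tensorFun_memLp (f : Tens μ ι) (g : Tens μ κ) :
    MemLp (fun w : ι ⊕ κ → X => f (w ∘ Sum.inl) * g (w ∘ Sum.inr)) 2
      (Measure.pi fun _ => μ) := by
  have h : MemLp (fun p : (ι → X) × (κ → X) => f p.1 * g p.2) 2
      ((Measure.pi fun _ => μ).prod (Measure.pi fun _ => μ)) := by
    have hm : AEStronglyMeasurable (fun p : (ι → X) × (κ → X) => f p.1 * g p.2)
        ((Measure.pi fun _ => μ).prod (Measure.pi fun _ => μ)) :=
      (Lp.aestronglyMeasurable f).comp_fst.mul (Lp.aestronglyMeasurable g).comp_snd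
    rw [memLp_two_iff_integrable_sq_norm hm]
    simp only [norm_mul, mul_pow]
    exact ((Lp.memLp f).integrable_norm_pow (by norm_num)).mul_prod
      ((Lp.memLp g).integrable_norm_pow (by norm_num))
  exact h.comp_measurePreserving (mp_split μ)

/-- The tensor product `f ⊗ g`, that is `(x, y) ↦ f(x) g(y)`. -/
noncomputable def tensor (f : Tens μ ι) (g : Tens μ κ) : Tens μ (ι ⊕ κ) :=
  (tensorFun_memLp f g).toLp _

theorem tensor_coe (f : Tens μ ι) (g : Tens μ κ) :
    tensor f g =ᵐ[Measure.pi fun _ => μ] fun w => f (w ∘ Sum.inl) * g (w ∘ Sum.inr) :=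
  (tensorFun_memLp f g).coeFn_toLp

theorem pureFun_memLp (f : ι → OneParticle μ) :
    MemLp (fun z : ι → X => ∏ i, f i (z i)) 2 (Measure.pi fun _ => μ) := by
  have hm : AEStronglyMeasurable (fun z : ι → X => ∏ i, f i (z i)) (Measure.pi fun _ => μ) := by
    refine Finset.aestronglyMeasurable_fun_prod _ fun i _ => ?_
    exact ((Lp.stronglyMeasurable (f i)).comp_measurable (measurable_pi_apply i)).aestronglyMeasurable
  rw [memLp_two_iff_integrable_sq_norm hm]
  simp only [norm_prod, ← Finset.prod_pow]
  have := Integrable.fintype_prod (ι := ι) (𝕜 := ℝ) (μ := fun _ => μ)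
    (f := fun i x => ‖f i x‖ ^ 2) fun i => (Lp.memLp (f i)).integrable_norm_pow (by norm_num)
  exact this

/-- The elementary tensor `⨂ᵢ fᵢ`, that is `z ↦ ∏ᵢ fᵢ(zᵢ)`. -/
noncomputable def pureTensor (f : ι → OneParticle μ) : Tens μ ι := (pureFun_memLp f).toLp _

theorem pureTensor_coe (f : ι → OneParticle μ) :
    pureTensor f =ᵐ[Measure.pi fun _ => μ] fun z => ∏ i, f i (z i) :=
  (pureFun_memLp f).coeFn_toLp

end Tensor

section Fock

variable {X : Type*} [MeasurableSpace X] {μ : Measure X} [SigmaFinite μ]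
  {ι κ τ : Type*} [Fintype ι] [Fintype κ] [Fintype τ]

theorem relabel_relabel (e : ι ≃ κ) (e' : κ ≃ τ) (f : Tens μ ι) :
    relabel e' (relabel e f) = relabel (e.trans e') f := by
  refine Lp.ext ?_
  filter_upwards [relabel_coe e' (relabel e f), relabel_coe (e.trans e') f,
    (mp_relabel μ e').quasiMeasurePreserving.ae (relabel_coe e f)] with z h1 h2 h3
  rw [h1, h2, h3]
  rfl

theorem relabel_refl (f : Tens μ ι) : relabel (Equiv.refl ι) f = f := by
  refine Lp.ext ?_
  filter_upwards [relabel_coe (Equiv.refl ι) f] with z h1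
  rw [h1]
  rfl

/-- The antisymmetrization operator `S₋ Ψ(z) = (1 / N!) ∑_σ sgn(σ) Ψ(z ∘ σ)` on `𝔥^{⊗N}`. -/
noncomputable def antisymm (N : ℕ) : Tens μ (Fin N) →L[ℂ] Tens μ (Fin N) :=
  ((N.factorial : ℂ))⁻¹ • ∑ σ : Equiv.Perm (Fin N),
    ((Equiv.Perm.sign σ : ℤ) : ℂ) • (relabel σ).toContinuousLinearMap

theorem antisymm_apply {N : ℕ} (Ψ : Tens μ (Fin N)) :
    antisymm N Ψ = ((N.factorial : ℂ))⁻¹ • ∑ σ : Equiv.Perm (Fin N),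
      ((Equiv.Perm.sign σ : ℤ) : ℂ) • relabel σ Ψ := by
  simp [antisymm]

theorem sign_sq {N : ℕ} (σ : Equiv.Perm (Fin N)) :
    ((Equiv.Perm.sign σ : ℤ) : ℂ) * ((Equiv.Perm.sign σ : ℤ) : ℂ) = 1 := by
  rw [← Int.cast_mul, ← Units.val_mul, Int.units_mul_self]; simp

theorem antisymm_relabel {N : ℕ} (σ : Equiv.Perm (Fin N)) (Ψ : Tens μ (Fin N)) :
    antisymm N (relabel σ Ψ) = ((Equiv.Perm.sign σ : ℤ) : ℂ) • antisymm N Ψ := by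
  rw [antisymm_apply, antisymm_apply, smul_comm]
  congr 1
  rw [Finset.smul_sum]
  refine Fintype.sum_equiv (Equiv.mulRight σ) _ _ fun ρ => ?_
  rw [relabel_relabel, smul_smul]
  have h1 : (Equiv.mulRight σ) ρ = σ.trans ρ := rfl
  have h2 : Equiv.Perm.sign (σ.trans ρ) = Equiv.Perm.sign ρ * Equiv.Perm.sign σ :=
    Equiv.Perm.sign_mul ρ σ
  rw [h1, h2, Units.val_mul, Int.cast_mul, mul_left_comm, sign_sq, mul_one]

theorem relabel_antisymm {N : ℕ} (σ : Equiv.Perm (Fin N)) (Ψ : Tens μ (Fin N)) :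
    relabel σ (antisymm N Ψ) = ((Equiv.Perm.sign σ : ℤ) : ℂ) • antisymm N Ψ := by
  rw [antisymm_apply, map_smul, map_sum, smul_comm]
  congr 1
  rw [Finset.smul_sum]
  refine Fintype.sum_equiv (Equiv.mulLeft σ) _ _ fun ρ => ?_
  rw [map_smul, relabel_relabel, smul_smul]
  have h1 : (Equiv.mulLeft σ) ρ = ρ.trans σ := rfl
  have h2 : Equiv.Perm.sign (ρ.trans σ) = Equiv.Perm.sign σ * Equiv.Perm.sign ρ :=
    Equiv.Perm.sign_mul σ ρ
  rw [h1, h2, Units.val_mul, Int.cast_mul, ← mul_assoc, sign_sq, one_mul]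

theorem antisymm_idem {N : ℕ} (Ψ : Tens μ (Fin N)) :
    antisymm N (antisymm N Ψ) = antisymm N Ψ := by
  conv_lhs => rw [antisymm_apply]
  simp only [relabel_antisymm, smul_smul, sign_sq, one_smul, Finset.sum_const, Finset.card_univ,
    Fintype.card_perm, Fintype.card_fin]
  rw [← Nat.cast_smul_eq_nsmul ℂ, smul_smul, inv_mul_cancel₀ (by exact_mod_cast N.factorial_ne_zero),
    one_smul]

theorem inner_relabel (e : ι ≃ κ) (f : Tens μ ι) (g : Tens μ κ) :
    inner ℂ (relabel e f) g = inner ℂ f (relabel e.symm g) := by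
  rw [← (relabel e).inner_map_map f (relabel e.symm g), relabel_relabel]
  simp [relabel_refl]

theorem inner_antisymm {N : ℕ} (Φ Ψ : Tens μ (Fin N)) :
    inner ℂ (antisymm N Φ) Ψ = inner ℂ Φ (antisymm N Ψ) := by
  simp only [antisymm_apply, inner_smul_left, inner_smul_right, sum_inner, inner_sum,
    inner_relabel]
  congr 1
  · simp
  · refine Fintype.sum_equiv (Equiv.inv _) _ _ fun σ => ?_
    simp only [Equiv.inv_apply, Equiv.Perm.sign_inv, map_intCast]
    rfl

variable (μ) in
/-- The fermionic `N`-particle space `S₋ 𝔥^{⊗N}`. -/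
noncomputable abbrev NParticle (N : ℕ) : Submodule ℂ (Tens μ (Fin N)) :=
  LinearMap.range (antisymm (μ := μ) N).toLinearMap

theorem antisymm_coe {N : ℕ} (Ψ : NParticle μ N) : antisymm N (Ψ : Tens μ (Fin N)) = Ψ := by
  obtain ⟨_, Φ, rfl⟩ := Ψ
  exact antisymm_idem Φ

instance (N : ℕ) : CompleteSpace (NParticle μ N) := by
  have h : (NParticle μ N : Set (Tens μ (Fin N))) = {Ψ | antisymm N Ψ = Ψ} := by
    ext Ψ
    constructor
    · rintro ⟨Φ, rfl⟩
      exact antisymm_idem Φ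
    · intro h
      exact ⟨Ψ, h⟩
  have hc : IsClosed (NParticle μ N : Set (Tens μ (Fin N))) := by
    rw [h]
    exact isClosed_eq (antisymm N).continuous continuous_id
  exact hc.completeSpace_coe

/-- `S₋`, as a map onto the fermionic `N`-particle space. -/
noncomputable def toNParticle (N : ℕ) : Tens μ (Fin N) →L[ℂ] NParticle μ N :=
  (antisymm N).codRestrict (NParticle μ N) fun Ψ => ⟨Ψ, rfl⟩

theorem toNParticle_coe {N : ℕ} (Ψ : Tens μ (Fin N)) :
    (toNParticle N Ψ : Tens μ (Fin N)) = antisymm N Ψ := rfl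

variable (μ) in
/-- The fermionic Fock space, the Hilbert space direct sum of all `S₋ 𝔥^{⊗N}`. -/
abbrev Fock : Type _ := lp (fun N : ℕ => NParticle μ N) 2

variable (μ) in
/-- The finite-particle space: vectors with only finitely many non-zero sectors. -/
def FinFock : Submodule ℂ (Fock μ) where
  carrier := {Ψ | ∃ K : ℕ, ∀ N > K, Ψ N = 0}
  add_mem' := by
    rintro Φ Ψ ⟨K, hK⟩ ⟨L, hL⟩
    refine ⟨max K L, fun N hN => ?_⟩
    rw [lp.coeFn_add, Pi.add_apply, hK N (lt_of_le_of_lt (le_max_left _ _) hN),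
      hL N (lt_of_le_of_lt (le_max_right _ _) hN), add_zero]
  zero_mem' := ⟨0, fun N _ => rfl⟩
  smul_mem' := by
    rintro c Ψ ⟨K, hK⟩
    refine ⟨K, fun N hN => ?_⟩
    rw [lp.coeFn_smul, Pi.smul_apply, hK N hN, smul_zero]

theorem memℓp_of_bounded_support {Ψ : ∀ N, NParticle μ N} {K : ℕ} (h : ∀ N > K, Ψ N = 0) :
    Memℓp Ψ 2 := by
  refine memℓp_gen ?_
  refine summable_of_ne_finset_zero (s := Finset.range (K + 1)) fun N hN => ?_
  rw [h N (by simpa using hN)]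
  simp

/-- The operator on the finite-particle space whose sector `M` is `T M`, where `T` raises the
particle number by at most `d`. -/
noncomputable def opOfSectors (T : ∀ M, (∀ N, NParticle μ N) →ₗ[ℂ] NParticle μ M) (d : ℕ)
    (hT : ∀ (Ψ : ∀ N, NParticle μ N) (K : ℕ), (∀ N > K, Ψ N = 0) → ∀ M > K + d, T M Ψ = 0) :
    Module.End ℂ (FinFock μ) where
  toFun Ψ := ⟨⟨fun M => T M (Ψ : Fock μ), by
      obtain ⟨K, hK⟩ := Ψ.2
      exact memℓp_of_bounded_support (hT _ K hK)⟩, by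
      obtain ⟨K, hK⟩ := Ψ.2
      exact ⟨K + d, hT _ K hK⟩⟩
  map_add' Φ Ψ := by
    refine Subtype.ext (lp.ext (funext fun M => ?_))
    exact map_add (T M) _ _
  map_smul' c Ψ := by
    refine Subtype.ext (lp.ext (funext fun M => ?_))
    exact map_smul (T M) c _

theorem opOfSectors_apply (T : ∀ M, (∀ N, NParticle μ N) →ₗ[ℂ] NParticle μ M) (d : ℕ)
    (hT : ∀ (Ψ : ∀ N, NParticle μ N) (K : ℕ), (∀ N > K, Ψ N = 0) → ∀ M > K + d, T M Ψ = 0)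
    (Ψ : FinFock μ) (M : ℕ) :
    (opOfSectors T d hT Ψ : Fock μ) M = T M (Ψ : Fock μ) := rfl

theorem finFock_ext {Φ Ψ : FinFock μ} (h : ∀ M, (Φ : Fock μ) M = (Ψ : Fock μ) M) : Φ = Ψ :=
  Subtype.ext (lp.ext (funext h))

/-- `n` legs in reversed order followed by `k` further particles, as `N = n + k` coordinates:
a function `Ψ` of `N` coordinates becomes `(x, z) ↦ Ψ(xₙ, …, x₁, z₁, …, z_k)`. -/
def legs (n k : ℕ) {N : ℕ} (h : n + k = N) : Fin n ⊕ Fin k ≃ Fin N :=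
  ((Equiv.sumCongr Fin.revPerm (Equiv.refl (Fin k))).trans finSumFinEquiv).trans (finCongr h)

/-- The part of `∫ f(x, y) a*_{xₙ} ⋯ a*_{x₁} a_{y₁} ⋯ a_{yₘ} dx dy` that maps the sector
`N = m + k` to the sector `M = n + k`: the vector `Ψ` is sent to
`√(N! / k!) √(M! / k!) S₋ [(xₙ, …, x₁, z) ↦ ∫ f(x, y) Ψ(yₘ, …, y₁, z) dy]`. -/
noncomputable def smearSector (n m k : ℕ) {N M : ℕ} (hN : m + k = N) (hM : n + k = M)
    (f : Tens μ (Fin n ⊕ Fin m)) : NParticle μ N →L[ℂ] NParticle μ M :=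
  ((√((N.factorial : ℝ) / k.factorial) * √((M.factorial : ℝ) / k.factorial) : ℝ) : ℂ) •
    ((toNParticle M) ∘L (relabel (legs n k hM)).toContinuousLinearMap ∘L (contract f) ∘L
      (relabel (legs m k hN).symm).toContinuousLinearMap ∘L (NParticle μ N).subtypeL)

/-- The operator `D^{(n,m)}(f) = ∫ f(x, y) a*_{xₙ} ⋯ a*_{x₁} a_{y₁} ⋯ a_{yₘ} dx dy` on the
finite-particle space, for a square-integrable kernel `f`. Between any two sectors it is bounded and
continuous in `f`; on elementary tensors it is a product of the operators `a*` and `a`, by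
`smear_pureTensor` below, which determines it. -/
noncomputable def smear (n m : ℕ) (f : Tens μ (Fin n ⊕ Fin m)) : Module.End ℂ (FinFock μ) :=
  opOfSectors
    (fun M => if h : n ≤ M then
        (smearSector n m (M - n) rfl (Nat.add_sub_cancel' h) f).toLinearMap ∘ₗ
          LinearMap.proj (m + (M - n))
      else 0) n
    (by
      intro Ψ K hK M hM
      have h : n ≤ M := by omega
      simp only [dif_pos h, LinearMap.comp_apply, LinearMap.proj_apply]
      rw [hK _ (by omega), map_zero])

theorem smear_apply {n m k N M : ℕ} (hN : m + k = N) (hM : n + k = M)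
    (f : Tens μ (Fin n ⊕ Fin m)) (Ψ : FinFock μ) :
    (smear n m f Ψ : Fock μ) M = smearSector n m k hN hM f ((Ψ : Fock μ) N) := by
  have h : n ≤ M := by omega
  obtain rfl : k = M - n := by omega
  subst hN
  rw [smear, opOfSectors_apply, dif_pos h]
  rfl

theorem smear_apply_of_lt {n m M : ℕ} (hM : M < n)
    (f : Tens μ (Fin n ⊕ Fin m)) (Ψ : FinFock μ) :
    (smear n m f Ψ : Fock μ) M = 0 := by
  rw [smear, opOfSectors_apply, dif_neg (by omega)]
  rfl

end Fock

section Adjoint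

variable {α β γ : Type*} [MeasurableSpace α] [MeasurableSpace β] [MeasurableSpace γ]
  {μ : Measure α} {ν : Measure β} {ρ : Measure γ} [SFinite μ] [SFinite ν] [SFinite ρ]

theorem mp_rotate : MeasurePreserving
    (fun q : (β × γ) × α => (((q.2, q.1.2), q.1.1) : (α × γ) × β))
    ((ν.prod ρ).prod μ) ((μ.prod ρ).prod ν) := by
  have h1 : MeasurePreserving (Prod.swap : (β × γ) × α → α × (β × γ))
      ((ν.prod ρ).prod μ) (μ.prod (ν.prod ρ)) := Measure.measurePreserving_swap
  have h2 : MeasurePreserving (Prod.map id Prod.swap : α × (β × γ) → α × (γ × β))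
      (μ.prod (ν.prod ρ)) (μ.prod (ρ.prod ν)) :=
    (MeasurePreserving.id μ).prod Measure.measurePreserving_swap
  have h3 : MeasurePreserving (MeasurableEquiv.prodAssoc (α := α) (β := γ) (γ := β)).symm
      (μ.prod (ρ.prod ν)) ((μ.prod ρ).prod ν) :=
    (measurePreserving_prodAssoc μ ρ ν).symm
  exact h3.comp (h2.comp h1)

theorem pair_adjoint {F : α × β → ℂ} {A : β × γ → ℂ} {B : α × γ → ℂ}
    (hF : MemLp F 2 (μ.prod ν)) (hA : MemLp A 2 (ν.prod ρ)) (hB : MemLp B 2 (μ.prod ρ)) :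
    ∫ p, star (pairFun ν F A p) * B p ∂(μ.prod ρ) =
      ∫ p, star (A p) * pairFun μ (fun q : β × α => star (F q.swap)) B p ∂(ν.prod ρ) := by
  let K : (α × γ) × β → ℂ := fun q => star (F (q.1.1, q.2)) * star (A (q.2, q.1.2)) * B q.1
  have hFm : AEStronglyMeasurable (fun q : (α × γ) × β => F (q.1.1, q.2)) ((μ.prod ρ).prod ν) := by
    have h : MeasurePreserving (fun q : (α × γ) × β => ((q.1.2, (q.1.1, q.2)) : γ × (α × β)))
        ((μ.prod ρ).prod ν) (ρ.prod (μ.prod ν)) :=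
      (measurePreserving_prodAssoc ρ μ ν).comp
        ((Measure.measurePreserving_swap (μ := μ) (ν := ρ)).prod (MeasurePreserving.id ν))
    exact (hF.1.comp_snd (μ := ρ)).comp_quasiMeasurePreserving h.quasiMeasurePreserving
  have hAm : AEStronglyMeasurable (fun q : (α × γ) × β => A (q.2, q.1.2)) ((μ.prod ρ).prod ν) := by
    have h : MeasurePreserving (fun q : (α × γ) × β => ((q.1.1, (q.2, q.1.2)) : α × (β × γ)))
        ((μ.prod ρ).prod ν) (μ.prod (ν.prod ρ)) :=
      ((MeasurePreserving.id μ).prod (Measure.measurePreserving_swap (μ := ρ) (ν := ν))).comp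
        (measurePreserving_prodAssoc μ ρ ν)
    exact (hA.1.comp_snd (μ := μ)).comp_quasiMeasurePreserving h.quasiMeasurePreserving
  have hKm : AEStronglyMeasurable K ((μ.prod ρ).prod ν) :=
    (hFm.star.mul hAm.star).mul hB.1.comp_fst
  have hK : Integrable K ((μ.prod ρ).prod ν) := by
    rw [integrable_prod_iff hKm]
    constructor
    · filter_upwards [pair_integrable hF hA] with p hp
      have : Integrable (fun y => star (F (p.1, y) * A (y, p.2)) * B p) ν :=
        ((LinearIsometryEquiv.integrable_comp_iff (starₗᵢ ℂ)).2 hp).mul_const (B p)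
      refine this.congr (Filter.Eventually.of_forall fun y => ?_)
      simp [K]
    · have hFn : MemLp (fun q => ((‖F q‖ : ℝ) : ℂ)) 2 (μ.prod ν) := hF.norm.ofReal
      have hAn : MemLp (fun q => ((‖A q‖ : ℝ) : ℂ)) 2 (ν.prod ρ) := hA.norm.ofReal
      have := ((pair_memLp hFn hAn).norm).integrable_mul hB.norm
      refine this.congr (Filter.Eventually.of_forall fun p => ?_)
      simp only [Pi.mul_apply, K, norm_mul, norm_star, pairFun]
      rw [integral_mul_const]
      congr 1
      have : ∀ y, ((‖F (p.1, y)‖ : ℝ) : ℂ) * ((‖A (y, p.2)‖ : ℝ) : ℂ) =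
        ((‖F (p.1, y)‖ * ‖A (y, p.2)‖ : ℝ) : ℂ) := fun y => by push_cast; rfl
      simp only [this]
      rw [integral_complex_ofReal, Complex.norm_real, Real.norm_of_nonneg]
      exact integral_nonneg fun y => by positivity
  have e1 : ∫ q, K q ∂((μ.prod ρ).prod ν) = ∫ p, star (pairFun ν F A p) * B p ∂(μ.prod ρ) := by
    rw [integral_prod _ hK]
    refine integral_congr_ae (Filter.Eventually.of_forall fun p => ?_)
    simp only [K, pairFun]
    rw [integral_mul_const]
    congr 1
    have := integral_conj (μ := ν) (f := fun y => F (p.1, y) * A (y, p.2))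
    simp only [map_mul] at this
    exact this
  let e : (β × γ) × α ≃ᵐ (α × γ) × β :=
    { toFun := fun q => ((q.2, q.1.2), q.1.1)
      invFun := fun q => ((q.2, q.1.2), q.1.1)
      left_inv := fun q => rfl
      right_inv := fun q => rfl
      measurable_toFun := by simp only [Equiv.coe_fn_mk]; fun_prop
      measurable_invFun := by simp only [Equiv.coe_fn_symm_mk]; fun_prop }
  have he : MeasurePreserving e ((ν.prod ρ).prod μ) ((μ.prod ρ).prod ν) := mp_rotate
  have hKe : Integrable (fun x => K (e x)) ((ν.prod ρ).prod μ) := he.integrable_comp_of_integrable hK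
  rw [← e1, ← he.integral_comp' K, integral_prod _ hKe]
  refine integral_congr_ae (Filter.Eventually.of_forall fun p => ?_)
  simp only [pairFun]
  rw [← integral_const_mul]
  refine integral_congr_ae (Filter.Eventually.of_forall fun y => ?_)
  simp only [K, e, MeasurableEquiv.coe_mk, Equiv.coe_fn_mk, Prod.swap_prod_mk]
  ring

end Adjoint

section CreationAnnihilation

variable {X : Type*} [MeasurableSpace X] {μ : Measure X} [SigmaFinite μ]
  {ι κ τ : Type*} [Fintype ι] [Fintype κ] [Fintype τ]

theorem tensor_norm_le (f : Tens μ ι) (g : Tens μ κ) : ‖tensor f g‖ ≤ ‖f‖ * ‖g‖ := by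
  rw [tensor, Lp.norm_toLp, Lp.norm_def, Lp.norm_def, ← ENNReal.toReal_mul]
  refine ENNReal.toReal_mono (ENNReal.mul_ne_top (Lp.eLpNorm_ne_top f) (Lp.eLpNorm_ne_top g)) ?_
  have h : eLpNorm (fun p : (ι → X) × (κ → X) => f p.1 * g p.2) 2
      ((Measure.pi fun _ => μ).prod (Measure.pi fun _ => μ)) =
      eLpNorm f 2 (Measure.pi fun _ => μ) * eLpNorm g 2 (Measure.pi fun _ => μ) := by
    refine (ENNReal.pow_right_strictMono two_ne_zero).injective ?_
    simp only [mul_pow, eLpNorm_two_sq, enorm_mul]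
    exact lintegral_prod_mul ((Lp.aestronglyMeasurable f).enorm.pow_const 2)
      ((Lp.aestronglyMeasurable g).enorm.pow_const 2)
  rw [← h]
  exact (eLpNorm_comp_measurePreserving
    ((Lp.aestronglyMeasurable f).comp_fst.mul (Lp.aestronglyMeasurable g).comp_snd)
    (mp_split μ)).le

/-- `Ψ ↦ f ⊗ Ψ` as a bounded linear map. -/
noncomputable def tensorLeft (f : Tens μ ι) : Tens μ κ →L[ℂ] Tens μ (ι ⊕ κ) :=
  LinearMap.mkContinuous
    { toFun := fun g => tensor f g
      map_add' := by
        intro g g'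
        refine Lp.ext ?_
        filter_upwards [tensor_coe f (g + g'), Lp.coeFn_add (tensor f g) (tensor f g'),
          tensor_coe f g, tensor_coe f g',
          (mp_split (ι := ι) μ).quasiMeasurePreserving.ae
            (Measure.quasiMeasurePreserving_snd.ae (Lp.coeFn_add g g'))] with w h1 h2 h3 h4 h5
        rw [h1, h2, Pi.add_apply, h3, h4, ← mul_add]
        exact congrArg _ h5
      map_smul' := by
        intro c g
        refine Lp.ext ?_
        filter_upwards [tensor_coe f (c • g), Lp.coeFn_smul c (tensor f g), tensor_coe f g,
          (mp_split (ι := ι) μ).quasiMeasurePreserving.ae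
            (Measure.quasiMeasurePreserving_snd.ae (Lp.coeFn_smul c g))] with w h1 h2 h3 h5
        rw [h1, RingHom.id_apply, h2, Pi.smul_apply, h3, smul_eq_mul, mul_left_comm]
        exact congrArg _ h5 }
    ‖f‖ (tensor_norm_le f)

theorem tensorLeft_apply (f : Tens μ ι) (g : Tens μ κ) : tensorLeft f g = tensor f g := rfl

/-- The creation operator on the `N`-particle sector, `a*(f) Ψ = √(N + 1) S₋ (f ⊗ Ψ)`. -/
noncomputable def createSector (f : OneParticle μ) (N : ℕ) :
    NParticle μ N →L[ℂ] NParticle μ (N + 1) :=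
  ((√(N + 1 : ℝ) : ℝ) : ℂ) •
    ((toNParticle (N + 1)) ∘L (relabel (legs 1 N (Nat.add_comm 1 N))).toContinuousLinearMap ∘L
      (tensorLeft (pureTensor fun _ : Fin 1 => f)) ∘L (NParticle μ N).subtypeL)

/-- The creation operator `a*(f)` on the finite-particle space. -/
noncomputable def create (f : OneParticle μ) : Module.End ℂ (FinFock μ) :=
  opOfSectors
    (fun M => match M with
      | 0 => 0
      | N + 1 => (createSector f N).toLinearMap ∘ₗ LinearMap.proj N) 1
    (by
      intro Ψ K hK M hM
      match M with
      | 0 => omega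
      | N + 1 =>
        simp only [LinearMap.comp_apply, LinearMap.proj_apply]
        rw [hK _ (by omega), map_zero])

/-- The annihilation operator `a(f)` on the finite-particle space, the adjoint of `a*(f)`. -/
noncomputable def annihilate (f : OneParticle μ) : Module.End ℂ (FinFock μ) :=
  opOfSectors
    (fun M => (ContinuousLinearMap.adjoint (createSector f M)).toLinearMap ∘ₗ
      LinearMap.proj (M + 1)) 0
    (by
      intro Ψ K hK M hM
      simp only [LinearMap.comp_apply, LinearMap.proj_apply]
      rw [hK _ (by omega), map_zero])

theorem contract_adjoint (f : Tens μ (ι ⊕ κ)) (A : Tens μ (κ ⊕ τ)) (B : Tens μ (ι ⊕ τ)) :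
    inner ℂ (contract f A) B =
      inner ℂ A (contract (star (relabel (Equiv.sumComm ι κ) f)) B) := by
  have h1 : inner ℂ (contract f A) B = ∫ w : ι ⊕ τ → X, star (contractFun f A w) * B w
      ∂(Measure.pi fun _ => μ) := by
    rw [L2.inner_def]
    refine integral_congr_ae ?_
    filter_upwards [contract_coe f A] with w hw
    simp [hw, mul_comm]
  have h2 : inner ℂ A (contract (star (relabel (Equiv.sumComm ι κ) f)) B) =
      ∫ w : κ ⊕ τ → X, star (A w) * contractFun (star (relabel (Equiv.sumComm ι κ) f)) B w
      ∂(Measure.pi fun _ => μ) := by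
    rw [L2.inner_def]
    refine integral_congr_ae ?_
    filter_upwards [contract_coe (star (relabel (Equiv.sumComm ι κ) f)) B] with w hw
    simp [hw, mul_comm]
  rw [h1, h2]
  have e1 := (measurePreserving_sumPiEquivProdPi (fun _ : ι ⊕ τ => μ)).integral_comp'
    (fun p => star (pairFun (Measure.pi fun _ => μ)
      (fun p : (ι → X) × (κ → X) => f (Sum.elim p.1 p.2))
      (fun p : (κ → X) × (τ → X) => A (Sum.elim p.1 p.2)) p) * B (Sum.elim p.1 p.2))
  have e2 := (measurePreserving_sumPiEquivProdPi (fun _ : κ ⊕ τ => μ)).integral_comp'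
    (fun p => star (A (Sum.elim p.1 p.2)) * pairFun (Measure.pi fun _ => μ)
      (fun q : (κ → X) × (ι → X) => star (f (Sum.elim q.swap.1 q.swap.2)))
      (fun p : (ι → X) × (τ → X) => B (Sum.elim p.1 p.2)) p)
  have e3 := pair_adjoint (memLp_join f) (memLp_join A) (memLp_join B)
  calc _ = _ := ?_
    _ = _ := e1.trans (e3.trans e2.symm)
    _ = _ := ?_
  · refine integral_congr_ae (Filter.Eventually.of_forall fun w => ?_)
    change _ = star (contractFun f A w) * B (Sum.elim (w ∘ Sum.inl) (w ∘ Sum.inr))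
    rw [Sum.elim_comp_inl_inr]
  · have hs : (star (relabel (Equiv.sumComm ι κ) f) : Tens μ (κ ⊕ ι)) =ᵐ[Measure.pi fun _ => μ]
        fun z => star (f (z ∘ Equiv.sumComm ι κ)) := by
      filter_upwards [Lp.coeFn_star (relabel (Equiv.sumComm ι κ) f),
        relabel_coe (Equiv.sumComm ι κ) f] with z h1 h2
      rw [h1, Pi.star_apply, h2]
    refine integral_congr_ae ?_
    filter_upwards [contractFun_congr hs (ae_eq_refl B)] with w hw
    change star (A (Sum.elim (w ∘ Sum.inl) (w ∘ Sum.inr))) * _ = _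
    rw [Sum.elim_comp_inl_inr]
    congr 1
    unfold pairFun contractFun
    refine integral_congr_ae ?_
    filter_upwards [hw] with y hy
    rw [hy.1]
    congr 3
    ext (i | i) <;> rfl

theorem smearSector_coe {n m k N M : ℕ} (hN : m + k = N) (hM : n + k = M)
    (f : Tens μ (Fin n ⊕ Fin m)) (Ψ : NParticle μ N) :
    (smearSector n m k hN hM f Ψ : Tens μ (Fin M)) =
      ((√((N.factorial : ℝ) / k.factorial) * √((M.factorial : ℝ) / k.factorial) : ℝ) : ℂ) •
        antisymm M (relabel (legs n k hM) (contract f (relabel (legs m k hN).symm Ψ))) := rfl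

theorem createSector_coe (f : OneParticle μ) (N : ℕ) (Ψ : NParticle μ N) :
    (createSector f N Ψ : Tens μ (Fin (N + 1))) = ((√(N + 1 : ℝ) : ℝ) : ℂ) •
      antisymm (N + 1) (relabel (legs 1 N (Nat.add_comm 1 N))
        (tensor (pureTensor fun _ : Fin 1 => f) Ψ)) := rfl

theorem smearSector_adjoint {n m k N M : ℕ} (hN : m + k = N) (hM : n + k = M)
    (f : Tens μ (Fin n ⊕ Fin m)) :
    ContinuousLinearMap.adjoint (smearSector n m k hN hM f) =
      smearSector m n k hM hN (star (relabel (Equiv.sumComm (Fin n) (Fin m)) f)) := by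
  symm
  rw [ContinuousLinearMap.eq_adjoint_iff]
  intro Φ Ψ
  have key : inner ℂ (smearSector n m k hN hM f Ψ : Tens μ (Fin M)) (Φ : Tens μ (Fin M)) =
      inner ℂ (Ψ : Tens μ (Fin N)) (smearSector m n k hM hN
      (star (relabel (Equiv.sumComm (Fin n) (Fin m)) f)) Φ : Tens μ (Fin N)) := by
    rw [smearSector_coe, smearSector_coe, inner_smul_left, inner_smul_right, Complex.conj_ofReal]
    rw [mul_comm (√((N.factorial : ℝ) / k.factorial))]
    congr 1
    rw [inner_antisymm, antisymm_coe, inner_relabel, contract_adjoint, ← inner_antisymm,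
      antisymm_coe, inner_relabel, Equiv.symm_symm]
  change inner ℂ (smearSector m n k hM hN
      (star (relabel (Equiv.sumComm (Fin n) (Fin m)) f)) Φ : Tens μ (Fin N)) (Ψ : Tens μ (Fin N)) =
    inner ℂ (Φ : Tens μ (Fin M)) (smearSector n m k hN hM f Ψ : Tens μ (Fin M))
  rw [← inner_conj_symm, ← key, inner_conj_symm]

theorem contract_tensor (E : Tens μ ι) (G : Tens μ κ) (Ψ : Tens μ (κ ⊕ τ)) :
    contract (tensor E G) Ψ =ᵐ[Measure.pi fun _ => μ]
      fun w => E (w ∘ Sum.inl) * ∫ y : κ → X, G y * Ψ (Sum.elim y (w ∘ Sum.inr))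
        ∂(Measure.pi fun _ => μ) := by
  filter_upwards [contract_coe (tensor E G) Ψ,
    contractFun_congr (tensor_coe E G) (ae_eq_refl Ψ)] with w h1 h2
  rw [h1, contractFun, ← integral_const_mul]
  refine integral_congr_ae ?_
  filter_upwards [h2] with y hy
  rw [hy.1, ← mul_assoc]
  rfl

end CreationAnnihilation

section Elementary

variable {X : Type*} [MeasurableSpace X] {μ : Measure X} [SigmaFinite μ]
  {ι κ τ : Type*} [Fintype ι] [Fintype κ] [Fintype τ]

theorem tensor_smul (f : Tens μ ι) (c : ℂ) (g : Tens μ κ) :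
    tensor f (c • g) = c • tensor f g := map_smul (tensorLeft f) c g

theorem tensor_relabel (f : Tens μ ι) (g : Tens μ κ) (e : κ ≃ τ) :
    tensor f (relabel e g) = relabel (Equiv.sumCongr (Equiv.refl ι) e) (tensor f g) := by
  refine Lp.ext ?_
  filter_upwards [tensor_coe f (relabel e g),
    relabel_coe (Equiv.sumCongr (Equiv.refl ι) e) (tensor f g),
    (mp_relabel μ (Equiv.sumCongr (Equiv.refl ι) e)).quasiMeasurePreserving.ae (tensor_coe f g),
    (mp_split (ι := ι) μ).quasiMeasurePreserving.ae
      (Measure.quasiMeasurePreserving_snd.ae (relabel_coe e g))] with w h1 h2 h3 h4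
  rw [h1, h2, h3]
  exact congrArg _ h4

/-- Inner antisymmetrizations may be dropped: `S₋ (f ⊗ S₋ Φ) = S₋ (f ⊗ Φ)`. -/
theorem antisymm_tensor_antisymm {k N : ℕ} (e : ι ⊕ Fin k ≃ Fin N) (f : Tens μ ι)
    (Φ : Tens μ (Fin k)) :
    antisymm N (relabel e (tensor f (antisymm k Φ))) = antisymm N (relabel e (tensor f Φ)) := by
  classical
  have h : ∀ σ : Equiv.Perm (Fin k), antisymm N (relabel e (tensor f (relabel σ Φ))) =
      ((Equiv.Perm.sign σ : ℤ) : ℂ) • antisymm N (relabel e (tensor f Φ)) := by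
    intro σ
    have h1 : (Equiv.sumCongr (Equiv.refl ι) σ).trans e =
        e.trans ((e.symm.trans (Equiv.Perm.sumCongr 1 σ)).trans e) := by
      ext i
      simp only [Equiv.trans_apply, Equiv.symm_apply_apply]
      rfl
    rw [tensor_relabel, relabel_relabel, h1, ← relabel_relabel, antisymm_relabel,
      Equiv.Perm.sign_symm_trans_trans, Equiv.Perm.sign_sumCongr]
    simp
  rw [antisymm_apply Φ, ← tensorLeft_apply, map_smul, map_sum, map_smul, map_sum, map_smul, map_sum]
  simp only [map_smul, tensorLeft_apply, h, smul_smul, sign_sq, one_smul, Finset.sum_const,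
    Finset.card_univ, Fintype.card_perm, Fintype.card_fin]
  rw [← Nat.cast_smul_eq_nsmul ℂ, smul_smul,
    inv_mul_cancel₀ (by exact_mod_cast k.factorial_ne_zero), one_smul]

theorem legs_inl {n k N : ℕ} (h : n + k = N) (i : Fin n) :
    ((legs n k h (Sum.inl i) : Fin N) : ℕ) = n - 1 - i := by
  simp [legs, Fin.val_rev]
  omega

theorem legs_inr {n k N : ℕ} (h : n + k = N) (i : Fin k) :
    ((legs n k h (Sum.inr i) : Fin N) : ℕ) = n + i := by
  simp [legs]

theorem smearSector_snoc {n m k N M : ℕ} (hN : m + k = N) (hM : n + k = M)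
    (hM' : n + 1 + k = M + 1) (f : Fin n → OneParticle μ) (f' : OneParticle μ)
    (G : Tens μ (Fin m)) (Ψ : NParticle μ N) :
    smearSector (n + 1) m k hN hM' (tensor (pureTensor (Fin.snoc f f' : Fin (n + 1) → _)) G) Ψ =
      createSector f' M (smearSector n m k hN hM (tensor (pureTensor f) G) Ψ) := by
  refine Subtype.ext ?_
  rw [createSector_coe, smearSector_coe, smearSector_coe, tensor_smul, map_smul, map_smul,
    antisymm_tensor_antisymm, smul_smul]
  congr 1
  · rw [← Complex.ofReal_mul]
    congr 1
    have hk : (0 : ℝ) < k.factorial := by exact_mod_cast k.factorial_pos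
    rw [mul_left_comm]
    congr 1
    rw [← Real.sqrt_mul (by positivity), Nat.factorial_succ]
    push_cast
    rw [mul_div_assoc]
  · congr 1
    refine Lp.ext ?_
    set Ψ' := relabel (legs m k hN).symm (Ψ : Tens μ (Fin N)) with hΨ'
    filter_upwards [relabel_coe (legs (n + 1) k hM')
        (contract (tensor (pureTensor (Fin.snoc f f' : Fin (n + 1) → OneParticle μ)) G) Ψ'),
      (mp_relabel μ (legs (n + 1) k hM')).quasiMeasurePreserving.ae
        (contract_tensor (pureTensor (Fin.snoc f f' : Fin (n + 1) → OneParticle μ)) G Ψ'),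
      (mp_relabel μ (legs (n + 1) k hM')).quasiMeasurePreserving.ae
        ((mp_split μ).quasiMeasurePreserving.ae (Measure.quasiMeasurePreserving_fst.ae
          (pureTensor_coe (Fin.snoc f f' : Fin (n + 1) → OneParticle μ)))),
      relabel_coe (legs 1 M (Nat.add_comm 1 M)) (tensor (pureTensor fun _ : Fin 1 => f')
        (relabel (legs n k hM) (contract (tensor (pureTensor f) G) Ψ'))),
      (mp_relabel μ (legs 1 M (Nat.add_comm 1 M))).quasiMeasurePreserving.ae
        (tensor_coe (pureTensor fun _ : Fin 1 => f')
          (relabel (legs n k hM) (contract (tensor (pureTensor f) G) Ψ'))),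
      (mp_relabel μ (legs 1 M (Nat.add_comm 1 M))).quasiMeasurePreserving.ae
        ((mp_split μ).quasiMeasurePreserving.ae (Measure.quasiMeasurePreserving_fst.ae
          (pureTensor_coe fun _ : Fin 1 => f'))),
      (mp_relabel μ (legs 1 M (Nat.add_comm 1 M))).quasiMeasurePreserving.ae
        ((mp_split μ).quasiMeasurePreserving.ae (Measure.quasiMeasurePreserving_snd.ae
          (relabel_coe (legs n k hM) (contract (tensor (pureTensor f) G) Ψ')))),
      (mp_relabel μ (legs 1 M (Nat.add_comm 1 M))).quasiMeasurePreserving.ae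
        ((mp_split μ).quasiMeasurePreserving.ae (Measure.quasiMeasurePreserving_snd.ae
          ((mp_relabel μ (legs n k hM)).quasiMeasurePreserving.ae
            (contract_tensor (pureTensor f) G Ψ')))),
      (mp_relabel μ (legs 1 M (Nat.add_comm 1 M))).quasiMeasurePreserving.ae
        ((mp_split μ).quasiMeasurePreserving.ae (Measure.quasiMeasurePreserving_snd.ae
          ((mp_relabel μ (legs n k hM)).quasiMeasurePreserving.ae
            ((mp_split μ).quasiMeasurePreserving.ae (Measure.quasiMeasurePreserving_fst.ae
              (pureTensor_coe f))))))]
      with z h1 h2 h3 h4 h5 h6 h7 h8 h9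
    rw [h1, h2, h3, h4, h5, h6, h7, h8, h9, ← mul_assoc]
    congr 1
    · simp only [Fin.prod_univ_castSucc, Fin.snoc_castSucc, Fin.snoc_last, Function.comp_apply,
        Finset.univ_eq_empty, Finset.prod_empty, one_mul]
      rw [mul_comm]
      congr 1
      · congr 2
        ext
        rw [legs_inl, legs_inl]
        simp
      · refine Finset.prod_congr rfl fun i _ => ?_
        congr 2
        ext
        rw [legs_inl, legs_inr, legs_inl]
        have := i.isLt
        simp
        omega
    · congr 1
      ext y
      congr 2
      ext (i | i)
      · rfl
      · simp only [Sum.elim_inr, Function.comp_apply]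
        congr 1
        ext
        rw [legs_inr, legs_inr, legs_inr]
        omega

theorem star_tensor (f : Tens μ ι) (g : Tens μ κ) :
    star (tensor f g) = tensor (star f) (star g) := by
  refine Lp.ext ?_
  filter_upwards [Lp.coeFn_star (tensor f g), tensor_coe f g, tensor_coe (star f) (star g),
    (mp_split (ι := ι) (κ := κ) μ).quasiMeasurePreserving.ae
      (Measure.quasiMeasurePreserving_fst.ae (Lp.coeFn_star f)),
    (mp_split (ι := ι) (κ := κ) μ).quasiMeasurePreserving.ae
      (Measure.quasiMeasurePreserving_snd.ae (Lp.coeFn_star g))] with w h1 h2 h3 h4 h5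
  rw [h1, Pi.star_apply, h2, h3, h4, h5, star_mul']
  rfl

theorem relabel_sumComm_tensor (f : Tens μ ι) (g : Tens μ κ) :
    relabel (Equiv.sumComm ι κ) (tensor f g) = tensor g f := by
  refine Lp.ext ?_
  filter_upwards [relabel_coe (Equiv.sumComm ι κ) (tensor f g), tensor_coe g f,
    (mp_relabel μ (Equiv.sumComm ι κ)).quasiMeasurePreserving.ae (tensor_coe f g)] with w h1 h2 h3
  rw [h1, h2, h3, mul_comm]
  rfl

theorem star_pureTensor (f : ι → OneParticle μ) :
    star (pureTensor f) = pureTensor fun i => star (f i) := by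
  refine Lp.ext ?_
  have h : ∀ᵐ z : ι → X ∂(Measure.pi fun _ => μ),
      ∀ i, (star (f i) : OneParticle μ) (z i) = star (f i (z i)) :=
    ae_all_iff.2 fun i => (Measure.quasiMeasurePreserving_eval (fun _ => μ) i).ae
      (Lp.coeFn_star (f i))
  filter_upwards [Lp.coeFn_star (pureTensor f), pureTensor_coe f,
    pureTensor_coe fun i => star (f i), h] with z h1 h2 h3 h4
  rw [h1, Pi.star_apply, h2, h3, star_prod]
  exact Finset.prod_congr rfl fun i _ => (h4 i).symm

theorem smear_snoc {n m : ℕ} (f : Fin n → OneParticle μ) (f' : OneParticle μ)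
    (G : Tens μ (Fin m)) :
    smear (n + 1) m (tensor (pureTensor (Fin.snoc f f' : Fin (n + 1) → _)) G) =
      create f' * smear n m (tensor (pureTensor f) G) := by
  refine LinearMap.ext fun Ψ => finFock_ext fun M => ?_
  rw [Module.End.mul_apply, create, opOfSectors_apply]
  match M with
  | 0 =>
    rw [smear_apply_of_lt (by omega)]
    rfl
  | M + 1 =>
    simp only [LinearMap.comp_apply, LinearMap.proj_apply]
    by_cases h : n ≤ M
    · rw [smear_apply (k := M - n) rfl (by omega : n + 1 + (M - n) = M + 1),
        smear_apply (k := M - n) rfl (by omega : n + (M - n) = M)]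
      exact smearSector_snoc _ _ _ f f' G _
    · rw [smear_apply_of_lt (by omega), smear_apply_of_lt (by omega), map_zero]

theorem smear_snoc_right {m : ℕ} (e : Fin 0 → OneParticle μ) (g : Fin m → OneParticle μ)
    (g' : OneParticle μ) :
    smear 0 (m + 1) (tensor (pureTensor e)
        (pureTensor fun i => star ((Fin.snoc g g' : Fin (m + 1) → OneParticle μ) i))) =
      smear 0 m (tensor (pureTensor e) (pureTensor fun i => star (g i))) * annihilate g' := by
  refine LinearMap.ext fun Ψ => finFock_ext fun M => ?_
  rw [Module.End.mul_apply, smear_apply (k := M) rfl (by omega : 0 + M = M),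
    smear_apply (k := M) rfl (by omega : 0 + M = M), annihilate, opOfSectors_apply]
  simp only [LinearMap.comp_apply, LinearMap.proj_apply]
  have key : ∀ (l : ℕ) (h : Fin l → OneParticle μ),
      smearSector 0 l M rfl (by omega : 0 + M = M)
        (tensor (pureTensor e) (pureTensor fun i => star (h i))) =
      ContinuousLinearMap.adjoint (smearSector l 0 M (by omega : 0 + M = M) rfl
        (tensor (pureTensor h) (pureTensor fun i => star (e i)))) := by
    intro l h
    rw [smearSector_adjoint, relabel_sumComm_tensor, star_tensor, star_pureTensor, star_pureTensor]
    simp only [star_star]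
  have e1 : m + 1 + M = m + M + 1 := by omega
  have e2 : ∀ {N : ℕ} (hN : m + 1 + M = N), smearSector 0 (m + 1) M rfl (by omega : 0 + M = M)
      (tensor (pureTensor e)
        (pureTensor fun i => star ((Fin.snoc g g' : Fin (m + 1) → OneParticle μ) i)))
        ((Ψ : Fock μ) (m + 1 + M)) = smearSector 0 (m + 1) M hN (by omega : 0 + M = M)
      (tensor (pureTensor e)
        (pureTensor fun i => star ((Fin.snoc g g' : Fin (m + 1) → OneParticle μ) i)))
        ((Ψ : Fock μ) N) := by
    rintro N rfl
    rfl
  rw [e2 e1, key m g]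
  have e3 : smearSector 0 (m + 1) M e1 (by omega : 0 + M = M)
      (tensor (pureTensor e)
        (pureTensor fun i => star ((Fin.snoc g g' : Fin (m + 1) → OneParticle μ) i))) =
      ContinuousLinearMap.adjoint (smearSector (m + 1) 0 M (by omega : 0 + M = M) e1
        (tensor (pureTensor (Fin.snoc g g' : Fin (m + 1) → OneParticle μ))
          (pureTensor fun i => star (e i)))) := by
    rw [smearSector_adjoint, relabel_sumComm_tensor, star_tensor, star_pureTensor, star_pureTensor]
    simp only [star_star]
  have e4 : smearSector (m + 1) 0 M (by omega : 0 + M = M) e1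
        (tensor (pureTensor (Fin.snoc g g' : Fin (m + 1) → OneParticle μ))
          (pureTensor fun i => star (e i))) = (createSector g' (m + M)) ∘L
      (smearSector m 0 M (by omega : 0 + M = M) rfl
        (tensor (pureTensor g) (pureTensor fun i => star (e i)))) :=
    ContinuousLinearMap.ext fun Φ => smearSector_snoc _ _ _ g g' _ Φ
  rw [e3, e4, ContinuousLinearMap.adjoint_comp]
  rfl

theorem smear_zero (e e' : Fin 0 → OneParticle μ) :
    smear 0 0 (tensor (pureTensor e) (pureTensor e')) = 1 := by
  refine LinearMap.ext fun Ψ => finFock_ext fun M => ?_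
  have h0 : 0 + M = M := Nat.zero_add M
  rw [smear_apply h0 h0]
  refine Subtype.ext ?_
  rw [smearSector_coe]
  have hk : ((M.factorial : ℝ) / M.factorial) = 1 :=
    div_self (by exact_mod_cast M.factorial_ne_zero)
  rw [hk, Real.sqrt_one, mul_one, Complex.ofReal_one, one_smul, Module.End.one_apply]
  conv_rhs => rw [← antisymm_coe]
  congr 1
  set Φ := ((Ψ : Fock μ) M : Tens μ (Fin M))
  have h : contract (tensor (pureTensor e) (pureTensor e')) (relabel (legs 0 M h0).symm Φ) =
      relabel (legs 0 M h0).symm Φ := by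
    refine Lp.ext ?_
    have hpr : IsProbabilityMeasure (Measure.pi fun _ : Fin 0 => μ) := by
      rw [Measure.pi_of_empty (fun _ : Fin 0 => μ) (fun i => i.elim0)]
      infer_instance
    have hp : ∀ e : Fin 0 → OneParticle μ, ∀ y, pureTensor e y = 1 := by
      intro e y
      have h := pureTensor_coe e
      obtain ⟨z, hz⟩ := h.exists
      rw [Subsingleton.elim y z, hz]
      simp
    filter_upwards [contract_tensor (pureTensor e) (pureTensor e') (relabel (legs 0 M h0).symm Φ)]
      with w hw
    have hc : ∀ y : Fin 0 → X, pureTensor e' y * relabel (legs 0 M h0).symm Φ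
        (Sum.elim y (w ∘ Sum.inr)) = relabel (legs 0 M h0).symm Φ w := by
      intro y
      rw [hp, one_mul, Subsingleton.elim y (w ∘ Sum.inl), Sum.elim_comp_inl_inr]
    rw [hw, hp, one_mul]
    simp only [hc]
    simp
  rw [h, relabel_relabel]
  simp [relabel_refl]

/-- On elementary tensors, `D^{(n,m)}(f₁ ⊗ ⋯ ⊗ fₙ ⊗ conj g₁ ⊗ ⋯ ⊗ conj gₘ)` is the product
`a*(fₙ) ⋯ a*(f₁) a(g₁) ⋯ a(gₘ)`. -/
theorem smear_pureTensor {n m : ℕ} (f : Fin n → OneParticle μ) (g : Fin m → OneParticle μ) :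
    smear n m (tensor (pureTensor f) (pureTensor fun k => star (g k))) =
      (List.ofFn fun j => create (f j.rev)).prod * (List.ofFn fun k => annihilate (g k)).prod := by
  induction n with
  | zero =>
    simp only [List.ofFn_zero, List.prod_nil, one_mul]
    induction m with
    | zero => simpa using smear_zero f fun k => star (g k)
    | succ m ih =>
      obtain ⟨g₁, g', rfl⟩ : ∃ (g₁ : Fin m → OneParticle μ) (g' : OneParticle μ),
          (Fin.snoc g₁ g' : Fin (m + 1) → OneParticle μ) = g := ⟨_, _, Fin.snoc_init_self g⟩
      rw [smear_snoc_right, ih, List.ofFn_succ', List.prod_concat]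
      simp
  | succ n ih =>
    obtain ⟨f₁, f', rfl⟩ : ∃ (f₁ : Fin n → OneParticle μ) (f' : OneParticle μ),
        (Fin.snoc f₁ f' : Fin (n + 1) → OneParticle μ) = f := ⟨_, _, Fin.snoc_init_self f⟩
    rw [smear_snoc, ih, List.ofFn_succ, List.prod_cons, mul_assoc]
    simp [Fin.rev_succ]

end Elementary

section Contractions

/-- The connectors that are not contracted (`𝒰` for `π`, and `𝒰'` for `π'`). -/
def uncontracted {C n : ℕ} (π : Fin C ↪ Fin n) : Finset (Fin n) :=
  (Finset.univ.map π)ᶜ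

theorem mem_uncontracted {C n : ℕ} (π : Fin C ↪ Fin n) (j : Fin n) :
    j ∈ uncontracted π ↔ ∀ c, π c ≠ j := by
  simp [uncontracted]

theorem card_uncontracted {C n : ℕ} (π : Fin C ↪ Fin n) : (uncontracted π).card = n - C := by
  simp [uncontracted, Finset.card_compl]

/-- The connectors, split into the contracted ones `π(1), …, π(C)` and the uncontracted ones. -/
noncomputable def splitLegs {C n : ℕ} (π : Fin C ↪ Fin n) :
    Fin C ⊕ {j // j ∈ uncontracted π} ≃ Fin n :=
  Equiv.ofBijective (Sum.elim π Subtype.val) (by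
    constructor
    · rintro (c | ⟨j, hj⟩) (d | ⟨k, hk⟩) h
      · exact congrArg _ (π.injective h)
      · exact absurd h ((mem_uncontracted π k).1 hk c)
      · exact absurd h.symm ((mem_uncontracted π j).1 hj d)
      · exact congrArg _ (Subtype.ext h)
    · intro j
      by_cases h : j ∈ uncontracted π
      · exact ⟨Sum.inr ⟨j, h⟩, rfl⟩
      · rw [mem_uncontracted] at h
        push Not at h
        obtain ⟨c, hc⟩ := h
        exact ⟨Sum.inl c, hc⟩)

/-- The uncontracted connectors, enumerated in increasing order. -/
def enumLegs {C n : ℕ} (π : Fin C ↪ Fin n) :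
    Fin (uncontracted π).card ≃ {j // j ∈ uncontracted π} :=
  ((uncontracted π).orderIsoOfFin rfl).toEquiv

/-- `σ` takes the contracted connectors into the maximally crossed position, `σ(π(c)) = n - c + 1`
for `1 ≤ c ≤ C` (with indices counted from `1`; below they are counted from `0`), while preserving
the order of all uncontracted connectors. -/
def IsCrossing {C n : ℕ} (π : Fin C ↪ Fin n) (σ : Equiv.Perm (Fin n)) : Prop :=
  (∀ c : Fin C, (σ (π c) : ℕ) + (c : ℕ) + 1 = n) ∧
    ∀ j ∈ uncontracted π, ∀ k ∈ uncontracted π, j < k → σ j < σ k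

theorem existsUnique_isCrossing {C n : ℕ} (π : Fin C ↪ Fin n) :
    ∃! σ : Equiv.Perm (Fin n), IsCrossing π σ := by
  have hC : C ≤ n := by simpa using Fintype.card_le_of_embedding π
  refine existsUnique_of_exists_of_unique ?_ ?_
  · let t : Fin C ⊕ {j // j ∈ uncontracted π} → Fin n :=
      Sum.elim (fun c => ⟨n - 1 - c, by omega⟩)
        (fun u => ⟨(enumLegs π).symm u, by
          have := ((enumLegs π).symm u).isLt
          have := card_uncontracted π
          omega⟩)
    have ht : Function.Injective t := by
      rintro (c | u) (d | v) h
      · have h' : n - 1 - (c : ℕ) = n - 1 - d := congrArg Fin.val h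
        refine congrArg _ (Fin.ext ?_)
        omega
      · have h' : n - 1 - (c : ℕ) = (enumLegs π).symm v := congrArg Fin.val h
        have := ((enumLegs π).symm v).isLt
        have := card_uncontracted π
        omega
      · have h' : ((enumLegs π).symm u : ℕ) = n - 1 - d := congrArg Fin.val h
        have := ((enumLegs π).symm u).isLt
        have := card_uncontracted π
        omega
      · have h' : ((enumLegs π).symm u : ℕ) = (enumLegs π).symm v :=
          congrArg (fun x : Fin n => (x : ℕ)) h
        exact congrArg _ ((enumLegs π).symm.injective (Fin.ext h'))
    have hb : Function.Bijective t :=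
      (Fintype.bijective_iff_injective_and_card t).2 ⟨ht, Fintype.card_congr (splitLegs π)⟩
    refine ⟨(splitLegs π).symm.trans (Equiv.ofBijective t hb), ?_, ?_⟩
    · intro c
      have h : (splitLegs π).symm (π c) = Sum.inl c := by
        rw [Equiv.symm_apply_eq]; rfl
      simp only [Equiv.trans_apply, h, Equiv.ofBijective_apply, t, Sum.elim_inl]
      omega
    · intro j hj k hk hjk
      have h1 : (splitLegs π).symm j = Sum.inr ⟨j, hj⟩ := by
        rw [Equiv.symm_apply_eq]; rfl
      have h2 : (splitLegs π).symm k = Sum.inr ⟨k, hk⟩ := by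
        rw [Equiv.symm_apply_eq]; rfl
      simp only [Equiv.trans_apply, h1, h2, Equiv.ofBijective_apply, t, Sum.elim_inr,
        Fin.mk_lt_mk]
      exact ((uncontracted π).orderIsoOfFin rfl).symm.strictMono (a := ⟨j, hj⟩) (b := ⟨k, hk⟩) hjk
  · intro σ τ hσ hτ
    let t : Fin C ↪ Fin n := ⟨fun c => ⟨n - 1 - c, by omega⟩, by
      intro c d h
      have h' : n - 1 - (c : ℕ) = n - 1 - d := congrArg Fin.val h
      refine Fin.ext ?_
      omega⟩
    have hcard : (uncontracted t).card = (uncontracted π).card := by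
      rw [card_uncontracted, card_uncontracted]
    have key : ∀ ρ : Equiv.Perm (Fin n), IsCrossing π ρ →
        (fun i => ρ (enumLegs π i)) = (uncontracted t).orderEmbOfFin hcard := by
      intro ρ hρ
      refine Finset.orderEmbOfFin_unique hcard (fun i => ?_) ?_
      · rw [mem_uncontracted]
        intro c h
        have h1 := hρ.1 c
        have h2 : ρ (π c) = t c := Fin.ext (by change (ρ (π c) : ℕ) = n - 1 - c; omega)
        have h3 := ρ.injective (h2.trans h)
        exact (mem_uncontracted π _).1 (enumLegs π i).2 c h3
      · intro i j hij
        exact hρ.2 _ (enumLegs π i).2 _ (enumLegs π j).2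
          (((uncontracted π).orderIsoOfFin rfl).strictMono hij)
    ext j
    by_cases h : j ∈ uncontracted π
    · have h1 := congrFun ((key σ hσ).trans (key τ hτ).symm) ((enumLegs π).symm ⟨j, h⟩)
      simp only [Equiv.apply_symm_apply] at h1
      rw [h1]
    · rw [mem_uncontracted] at h
      push Not at h
      obtain ⟨c, rfl⟩ := h
      have h1 := hσ.1 c
      have h2 := hτ.1 c
      omega

/-- The unique permutation that takes the connectors into the maximally crossed form. -/
noncomputable def crossing {C n : ℕ} (π : Fin C ↪ Fin n) : Equiv.Perm (Fin n) :=
  (existsUnique_isCrossing π).choose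

theorem crossing_spec {C n : ℕ} (π : Fin C ↪ Fin n) : IsCrossing π (crossing π) :=
  (existsUnique_isCrossing π).choose_spec.1

/-- The sign of a contraction configuration,
`sgn(π, π') = (-1)^((m - C)(n - C)) sgn(σ) sgn(σ')`. -/
noncomputable def configSign {C m n : ℕ} (π : Fin C ↪ Fin n) (π' : Fin C ↪ Fin m) : ℤ :=
  (-1) ^ ((m - C) * (n - C)) * Equiv.Perm.sign (crossing π) * Equiv.Perm.sign (crossing π')

variable {X : Type*} [MeasurableSpace X] {μ : Measure X} [SigmaFinite μ] {nA mA nB mB : ℕ}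

/-- The kernel `∫ f_A(x_A, y_A) f_B(x_B, y_B) ∏_c δ(x_{π(c)} - y_{π'(c)})`, where the integral is
over the contracted coordinates, as a function of the uncontracted ones. -/
noncomputable def contractedKernel {C : ℕ} (π : Fin C ↪ Fin nB) (π' : Fin C ↪ Fin mA)
    (fA : Tens μ (Fin nA ⊕ Fin mA)) (fB : Tens μ (Fin nB ⊕ Fin mB)) :
    Tens μ ((Fin nA ⊕ {j // j ∈ uncontracted π'}) ⊕ ({j // j ∈ uncontracted π} ⊕ Fin mB)) :=
  contract
    (relabel (((Equiv.refl (Fin nA)).sumCongr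
      ((splitLegs π').symm.trans (Equiv.sumComm _ _))).trans (Equiv.sumAssoc _ _ _).symm) fA)
    (relabel (((splitLegs π).symm.sumCongr (Equiv.refl (Fin mB))).trans
      (Equiv.sumAssoc _ _ _)) fB)

/-- The contribution of one contraction configuration,
`∫ f_A f_B ∏_c δ(x_{π(c)} - y_{π'(c)}) (∏_ℓ a_{A,ℓ})* (∏_{u ∈ 𝒰} a_u)* ∏_{u' ∈ 𝒰'} a_{u'} ∏_ℓ a_{B,ℓ}`.
The creation operators read, from right to left, first `𝒰` in increasing order and then
`x_{A,1}, …, x_{A,n_A}`; the annihilation operators read, from left to right, first `𝒰'` in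
increasing order and then `y_{B,1}, …, y_{B,m_B}`. -/
noncomputable def contribution {C : ℕ} (π : Fin C ↪ Fin nB) (π' : Fin C ↪ Fin mA)
    (fA : Tens μ (Fin nA ⊕ Fin mA)) (fB : Tens μ (Fin nB ⊕ Fin mB)) :
    Module.End ℂ (FinFock μ) :=
  smear ((uncontracted π).card + nA) ((uncontracted π').card + mB)
    (relabel ((Equiv.sumSumSumComm _ _ _ _).trans (Equiv.sumCongr
      (((Equiv.sumComm _ _).trans ((enumLegs π).symm.sumCongr (Equiv.refl _))).trans
        finSumFinEquiv)
      (((enumLegs π').symm.sumCongr (Equiv.refl _)).trans finSumFinEquiv)))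
      (contractedKernel π π' fA fB))

/-- The fermionic attached product `A ∘ B`: the signed sum of the contributions of all
configurations of `1 ≤ C ≤ min(m_A, n_B)` contractions, where `π` is strictly decreasing and `π'`
is injective. -/
noncomputable def attached (fA : Tens μ (Fin nA ⊕ Fin mA)) (fB : Tens μ (Fin nB ⊕ Fin mB)) :
    Module.End ℂ (FinFock μ) :=
  ∑ C ∈ Finset.Icc 1 (min mA nB), ∑ π : {π : Fin C ↪ Fin nB // StrictAnti π},
    ∑ π' : Fin C ↪ Fin mA, configSign π.1 π' • contribution π.1 π' fA fB

/-- The normal ordered product `:AB:`,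
`∫ f_A f_B (∏_ℓ a_{A,ℓ})* (∏_ℓ a_{B,ℓ})* (∏_ℓ a_{A,ℓ}) (∏_ℓ a_{B,ℓ})`. The creation operators
read, from right to left, first `x_{B,1}, …, x_{B,n_B}` and then `x_{A,1}, …, x_{A,n_A}`. -/
noncomputable def normalOrdered (fA : Tens μ (Fin nA ⊕ Fin mA)) (fB : Tens μ (Fin nB ⊕ Fin mB)) :
    Module.End ℂ (FinFock μ) :=
  smear (nB + nA) (mA + mB)
    (relabel ((Equiv.sumSumSumComm _ _ _ _).trans (Equiv.sumCongr
      ((Equiv.sumComm _ _).trans finSumFinEquiv) finSumFinEquiv)) (tensor fA fB))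

end Contractions

end Friedrichs

/-!
The formula is proved sector by sector on the integral kernels; no density argument and no
induction over commutation relations is needed.

On a vector `Ψ` with `N` particles, `A B Ψ` is the contraction of `f_A` with the antisymmetrization
of the contraction of `f_B` with `Ψ`. Written out, the antisymmetrization in the middle is a signed
sum over permutations, and each permutation is a bijection ("wiring") from the creation legs of `B`
together with the `k_B` particles that `B` does not touch to the annihilation legs of `A` together
with the `k_A` particles that `A` does not touch (`smearSector_smearSector`). Let `C` creation legs
of `B` be joined to annihilation legs of `A`. Then by Fubini (`contract_assoc`) one may integrate
over the `C` joined coordinates first, which gives the contracted kernel of a configuration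
`(π, π')`, now applied to `Ψ`. How the remaining legs are placed among the untouched particles
matters only through a sign, because `Ψ` and the result are antisymmetric
(`antisymm_contract_wiring`). The total sign is that of the configuration: `σ` and `σ'` bring the
legs into the standard position, and there the wiring only moves a block of `n_B - C` legs past a
block of `m_A - C` legs (`sign_wiring`, `crossing_eq`).

It remains to count. A wiring determines `(π, π')`, with `π` strictly decreasing, and the placements
of the uncontracted legs, up to a common relabelling of the `r` particles touched neither by `A` nor
by `B`. So each configuration stands for `k_A! k_B! / r!` wirings (`factorial_smul_sum_wirings`),
which turns the normalization of the product `A B` into that of a single operator `D^{(n,m)}`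
(`sum_wiringTerm`). The configuration with `C = 0` gives the normal ordered product
(`contribution_zero`).
-/

namespace Friedrichs

/-! ### Contractions of kernels -/

section ProductSpaces

variable {I K A B L R : Type*} [MeasurableSpace I] [MeasurableSpace K] [MeasurableSpace A]
  [MeasurableSpace B] [MeasurableSpace L] [MeasurableSpace R]
  {μI : Measure I} {μK : Measure K} {μA : Measure A} {μB : Measure B} {μL : Measure L}
  {μR : Measure R} [SFinite μI] [SFinite μK] [SFinite μA] [SFinite μB] [SFinite μL] [SFinite μR]

theorem measurePreserving_prodProdProdComm : MeasurePreserving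
    (fun q : (K × A) × (B × R) => ((q.1.1, q.2.1), (q.1.2, q.2.2)))
    ((μK.prod μA).prod (μB.prod μR)) ((μK.prod μB).prod (μA.prod μR)) := by
  have h1 := measurePreserving_prodAssoc μK μA (μB.prod μR)
  have h2 : MeasurePreserving (fun q : A × (B × R) => (q.2.1, (q.1, q.2.2)))
      (μA.prod (μB.prod μR)) (μB.prod (μA.prod μR)) :=
    (measurePreserving_prodAssoc μB μA μR).comp
      (((Measure.measurePreserving_swap (μ := μA) (ν := μB)).prod (MeasurePreserving.id μR)).comp
        (measurePreserving_prodAssoc μA μB μR).symm)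
  exact (measurePreserving_prodAssoc μK μB (μA.prod μR)).symm.comp
    (((MeasurePreserving.id μK).prod h2).comp h1)

/-- Fubini for three square-integrable kernels: integrating `G` against `P` first and then against
`F` is the same as integrating `F` against `G` first and then against `P`. -/
theorem ae_pair_assoc {F : I × (K × A) → ℂ} {G : (K × B) × L → ℂ} {P : L × (A × R) → ℂ}
    (mF : StronglyMeasurable F) (mG : StronglyMeasurable G) (mP : StronglyMeasurable P)
    (hF : MemLp F 2 (μI.prod (μK.prod μA))) (hG : MemLp G 2 ((μK.prod μB).prod μL))
    (hP : MemLp P 2 (μL.prod (μA.prod μR))) :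
    ∀ᵐ w ∂(μI.prod (μB.prod μR)),
      ∫ u, F (w.1, u) * (∫ l, G ((u.1, w.2.1), l) * P (l, (u.2, w.2.2)) ∂μL) ∂(μK.prod μA) =
      ∫ v, (∫ k, F (w.1, (k, v.1)) * G ((k, w.2.1), v.2) ∂μK) * P (v.2, (v.1, w.2.2))
        ∂(μA.prod μL) := by
  -- Tonelli: the absolute values `|G|` and `|P|` pair to a square-integrable kernel, whose pairing
  -- with `F` is finite almost everywhere; so the triple integrand is integrable for almost every `w`
  have hGn : MemLp (fun q => ((‖G q‖ : ℝ) : ℂ)) 2 ((μK.prod μB).prod μL) := hG.norm.ofReal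
  have hPn : MemLp (fun q => ((‖P q‖ : ℝ) : ℂ)) 2 (μL.prod (μA.prod μR)) := hP.norm.ofReal
  have h1 : ∀ᵐ w ∂(μI.prod (μB.prod μR)), ∀ᵐ u ∂(μK.prod μA),
      Integrable (fun l => G ((u.1, w.2.1), l) * P (l, (u.2, w.2.2))) μL := by
    have h : ∀ᵐ q ∂((μB.prod μR).prod (μK.prod μA)),
        Integrable (fun l => G ((q.2.1, q.1.1), l) * P (l, (q.2.2, q.1.2))) μL :=
      (measurePreserving_prodProdProdComm.comp
        Measure.measurePreserving_swap).quasiMeasurePreserving.ae (pair_integrable hG hP)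
    have h' : ∀ᵐ c ∂(μB.prod μR), ∀ᵐ u ∂(μK.prod μA),
        Integrable (fun l => G ((u.1, c.1), l) * P (l, (u.2, c.2))) μL := Measure.ae_ae_of_ae_prod h
    have h'' := (Measure.quasiMeasurePreserving_snd (μ := μI) (ν := μB.prod μR)).ae h'
    exact h''
  have hH : MemLp ((pairFun μL (fun q => ((‖G q‖ : ℝ) : ℂ)) (fun q => ((‖P q‖ : ℝ) : ℂ))) ∘
      fun q : (K × A) × (B × R) => ((q.1.1, q.2.1), (q.1.2, q.2.2))) 2
      ((μK.prod μA).prod (μB.prod μR)) :=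
    (pair_memLp hGn hPn).comp_measurePreserving measurePreserving_prodProdProdComm
  have h2 := pair_integrable hF hH
  filter_upwards [h1, h2] with w hw1 hw2
  let Q : (K × A) × L → ℂ := fun q =>
    F (w.1, q.1) * (G ((q.1.1, w.2.1), q.2) * P (q.2, (q.1.2, w.2.2)))
  have mQ : StronglyMeasurable Q :=
    (mF.comp_measurable (by fun_prop)).mul
      ((mG.comp_measurable (by fun_prop)).mul (mP.comp_measurable (by fun_prop)))
  have hQ : Integrable Q ((μK.prod μA).prod μL) := by
    rw [integrable_prod_iff mQ.aestronglyMeasurable]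
    refine ⟨?_, ?_⟩
    · filter_upwards [hw1] with u hu
      exact hu.const_mul (F (w.1, u))
    · refine hw2.norm.congr (Filter.Eventually.of_forall fun u => ?_)
      simp only [Q, norm_mul, integral_const_mul, pairFun, Function.comp_apply]
      congr 1
      simp only [← Complex.ofReal_mul]
      rw [integral_complex_ofReal, Complex.norm_real, Real.norm_of_nonneg]
      exact integral_nonneg fun y => by positivity
  have e := measurePreserving_prodAssoc μK μA μL
  have hQ' : Integrable (fun q : K × (A × L) => Q ((q.1, q.2.1), q.2.2))
      (μK.prod (μA.prod μL)) := e.symm.integrable_comp_of_integrable hQ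
  have e1 : ∫ q, Q q ∂((μK.prod μA).prod μL) =
      ∫ q : K × (A × L), Q ((q.1, q.2.1), q.2.2) ∂(μK.prod (μA.prod μL)) :=
    (e.symm.integral_comp' Q).symm
  have e2 : ∫ q, Q q ∂((μK.prod μA).prod μL) = ∫ u, F (w.1, u) *
      (∫ l, G ((u.1, w.2.1), l) * P (l, (u.2, w.2.2)) ∂μL) ∂(μK.prod μA) := by
    rw [integral_prod _ hQ]
    simp only [Q, integral_const_mul]
  have e3 : ∫ q : K × (A × L), Q ((q.1, q.2.1), q.2.2) ∂(μK.prod (μA.prod μL)) =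
      ∫ v, (∫ k, F (w.1, (k, v.1)) * G ((k, w.2.1), v.2) ∂μK) * P (v.2, (v.1, w.2.2))
        ∂(μA.prod μL) := by
    rw [integral_prod_symm _ hQ']
    simp only [Q, ← mul_assoc, integral_mul_const]
  exact e2.symm.trans (e1.trans e3)

end ProductSpaces

section Contract

variable {X : Type*} [MeasurableSpace X] {μ : Measure X} [SigmaFinite μ]
  {ι κ τ α β ρ l ι' κ' τ' : Type*} [Fintype ι] [Fintype κ] [Fintype τ] [Fintype α] [Fintype β]
  [Fintype ρ] [Fintype l] [Fintype ι'] [Fintype κ'] [Fintype τ']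

theorem integral_comp_relabel (e : ι ≃ κ) (F : (ι → X) → ℂ) :
    ∫ z : κ → X, F (z ∘ e) ∂(Measure.pi fun _ => μ) = ∫ z, F z ∂(Measure.pi fun _ => μ) :=
  (measurePreserving_piCongrLeft (fun _ : κ => μ) e).symm.integral_comp' F

theorem integral_split (F : (ι → X) × (κ → X) → ℂ) :
    ∫ w : ι ⊕ κ → X, F (w ∘ Sum.inl, w ∘ Sum.inr) ∂(Measure.pi fun _ => μ) =
      ∫ p, F p ∂((Measure.pi fun _ => μ).prod (Measure.pi fun _ => μ)) :=
  (measurePreserving_sumPiEquivProdPi (fun _ : ι ⊕ κ => μ)).integral_comp' F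

/-- Contraction is natural in all coordinates; a relabelling of the contracted coordinates drops
out when it is the same in both kernels. -/
theorem contract_relabel (u : ι ≃ ι') (v : κ ≃ κ') (w : τ ≃ τ') (f : Tens μ (ι ⊕ κ))
    (g : Tens μ (κ ⊕ τ)) :
    contract (relabel (Equiv.sumCongr u v) f) (relabel (Equiv.sumCongr v w) g) =
      relabel (Equiv.sumCongr u w) (contract f g) := by
  refine Lp.ext ?_
  filter_upwards [contract_coe (relabel (Equiv.sumCongr u v) f) (relabel (Equiv.sumCongr v w) g),
    contractFun_congr (relabel_coe (Equiv.sumCongr u v) f) (relabel_coe (Equiv.sumCongr v w) g),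
    relabel_coe (Equiv.sumCongr u w) (contract f g),
    (mp_relabel μ (Equiv.sumCongr u w)).quasiMeasurePreserving.ae (contract_coe f g)]
    with z h1 h2 h3 h4
  rw [h1, h3, h4, contractFun, contractFun, ← integral_comp_relabel v]
  refine integral_congr_ae ?_
  filter_upwards [h2] with y hy
  rw [hy.1, hy.2]
  congr 2 <;> · ext (i | i) <;> rfl

/-- Associativity of contraction. The first `κ`-coordinates join `f` to `g`, the `α`-coordinates
join `f` to `Ψ` and the `l`-coordinates join `g` to `Ψ`: one may contract `g` with `Ψ` first and
then `f` with the result, or first `f` with `g` and then the result with `Ψ`. -/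
theorem contract_assoc (f : Tens μ (ι ⊕ (κ ⊕ α))) (g : Tens μ ((κ ⊕ β) ⊕ l))
    (Ψ : Tens μ (l ⊕ (α ⊕ ρ))) :
    contract f (relabel (Equiv.sumSumSumComm κ β α ρ) (contract g Ψ)) =
      relabel (Equiv.sumAssoc ι β ρ) (contract
        (relabel (Equiv.sumSumSumComm ι α β l)
          (contract (relabel ((Equiv.sumCongr (Equiv.refl ι) (Equiv.sumComm κ α)).trans
            (Equiv.sumAssoc ι α κ).symm) f) (relabel (Equiv.sumAssoc κ β l) g)))
        (relabel ((Equiv.sumAssoc l α ρ).symm.trans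
          (Equiv.sumCongr (Equiv.sumComm l α) (Equiv.refl ρ))) Ψ)) := by
  set f' := relabel ((Equiv.sumCongr (Equiv.refl ι) (Equiv.sumComm κ α)).trans
            (Equiv.sumAssoc ι α κ).symm) f with hf'
  set g' := relabel (Equiv.sumAssoc κ β l) g with hg'
  set Ψ' := relabel ((Equiv.sumAssoc l α ρ).symm.trans
          (Equiv.sumCongr (Equiv.sumComm l α) (Equiv.refl ρ))) Ψ with hΨ'
  have mpF : MeasurePreserving
      (fun p : (ι → X) × ((κ → X) × (α → X)) => (Sum.elim p.1 (Sum.elim p.2.1 p.2.2)))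
      ((Measure.pi fun _ => μ).prod ((Measure.pi fun _ => μ).prod (Measure.pi fun _ => μ)))
      (Measure.pi fun _ : ι ⊕ (κ ⊕ α) => μ) :=
    (mp_join μ).comp ((MeasurePreserving.id _).prod (mp_join μ))
  have mpG : MeasurePreserving
      (fun p : ((κ → X) × (β → X)) × (l → X) => (Sum.elim (Sum.elim p.1.1 p.1.2) p.2))
      (((Measure.pi fun _ => μ).prod (Measure.pi fun _ => μ)).prod (Measure.pi fun _ => μ))
      (Measure.pi fun _ : (κ ⊕ β) ⊕ l => μ) :=
    (mp_join μ).comp ((mp_join μ).prod (MeasurePreserving.id _))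
  have mpP : MeasurePreserving
      (fun p : (l → X) × ((α → X) × (ρ → X)) => (Sum.elim p.1 (Sum.elim p.2.1 p.2.2)))
      ((Measure.pi fun _ => μ).prod ((Measure.pi fun _ => μ).prod (Measure.pi fun _ => μ)))
      (Measure.pi fun _ : l ⊕ (α ⊕ ρ) => μ) :=
    (mp_join μ).comp ((MeasurePreserving.id _).prod (mp_join μ))
  have mpW : MeasurePreserving
      (fun w : ι ⊕ (β ⊕ ρ) → X => (w ∘ Sum.inl, ((w ∘ Sum.inr) ∘ Sum.inl, (w ∘ Sum.inr) ∘ Sum.inr)))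
      (Measure.pi fun _ => μ)
      ((Measure.pi fun _ => μ).prod ((Measure.pi fun _ => μ).prod (Measure.pi fun _ => μ))) :=
    ((MeasurePreserving.id _).prod (mp_split μ)).comp (mp_split μ)
  have key := mpW.quasiMeasurePreserving.ae (ae_pair_assoc
    ((Lp.stronglyMeasurable f).comp_measurable mpF.measurable)
    ((Lp.stronglyMeasurable g).comp_measurable mpG.measurable)
    ((Lp.stronglyMeasurable Ψ).comp_measurable mpP.measurable)
    ((Lp.memLp f).comp_measurePreserving mpF) ((Lp.memLp g).comp_measurePreserving mpG)
    ((Lp.memLp Ψ).comp_measurePreserving mpP))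
  have hgΨ : relabel (Equiv.sumSumSumComm κ β α ρ) (contract g Ψ) =ᵐ[Measure.pi fun _ => μ]
      fun z => contractFun g Ψ (z ∘ Equiv.sumSumSumComm κ β α ρ) := by
    filter_upwards [relabel_coe (Equiv.sumSumSumComm κ β α ρ) (contract g Ψ),
      (mp_relabel μ (Equiv.sumSumSumComm κ β α ρ)).quasiMeasurePreserving.ae (contract_coe g Ψ)]
      with z h1 h2
    rw [h1, h2]
  have hfg : relabel (Equiv.sumSumSumComm ι α β l) (contract f' g') =ᵐ[Measure.pi fun _ => μ]
      fun z => ∫ k : κ → X, f (Sum.elim (z ∘ Sum.inl ∘ Sum.inl)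
        (Sum.elim k (z ∘ Sum.inr ∘ Sum.inl))) *
        g (Sum.elim (Sum.elim k (z ∘ Sum.inl ∘ Sum.inr)) (z ∘ Sum.inr ∘ Sum.inr))
        ∂(Measure.pi fun _ => μ) := by
    filter_upwards [relabel_coe (Equiv.sumSumSumComm ι α β l) (contract f' g'),
      (mp_relabel μ (Equiv.sumSumSumComm ι α β l)).quasiMeasurePreserving.ae (contract_coe f' g'),
      (mp_relabel μ (Equiv.sumSumSumComm ι α β l)).quasiMeasurePreserving.ae
        (contractFun_congr (relabel_coe ((Equiv.sumCongr (Equiv.refl ι) (Equiv.sumComm κ α)).trans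
            (Equiv.sumAssoc ι α κ).symm) f) (relabel_coe (Equiv.sumAssoc κ β l) g))]
      with z h1 h2 h3
    rw [h1, h2, contractFun]
    refine integral_congr_ae ?_
    filter_upwards [h3] with k hk
    rw [hk.1, hk.2]
    congr 2
    · ext (i | i | i) <;> rfl
    · ext ((i | i) | i) <;> rfl
  refine Lp.ext ?_
  filter_upwards [contract_coe f (relabel (Equiv.sumSumSumComm κ β α ρ) (contract g Ψ)),
    contractFun_congr (ae_eq_refl f) hgΨ,
    relabel_coe (Equiv.sumAssoc ι β ρ)
      (contract (relabel (Equiv.sumSumSumComm ι α β l) (contract f' g')) Ψ'),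
    (mp_relabel μ (Equiv.sumAssoc ι β ρ)).quasiMeasurePreserving.ae
      (contract_coe (relabel (Equiv.sumSumSumComm ι α β l) (contract f' g')) Ψ'),
    (mp_relabel μ (Equiv.sumAssoc ι β ρ)).quasiMeasurePreserving.ae
      (contractFun_congr hfg (relabel_coe ((Equiv.sumAssoc l α ρ).symm.trans
          (Equiv.sumCongr (Equiv.sumComm l α) (Equiv.refl ρ))) Ψ)), key]
    with w h1 h2 h3 h4 h5 h6
  rw [h1, h3, h4]
  simp only [Function.comp_apply] at h6
  refine Eq.trans (integral_congr_ae ?_) ((integral_split (ι := κ) (κ := α) (μ := μ) _).trans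
    (h6.trans ((integral_split (ι := α) (κ := l) (μ := μ) _).symm.trans (integral_congr_ae ?_))))
  · filter_upwards [h2] with y hy
    rw [hy.2, contractFun]
    congr 1
    · congr 1
      ext (i | i | i) <;> rfl
    · congr 1
      ext y'
      congr 2
      · ext ((i | i) | i) <;> rfl
      · ext (i | i | i) <;> rfl
  · filter_upwards [h5] with y hy
    rw [hy.1, hy.2]
    congr 1
    congr 1
    ext (i | i | i) <;> rfl

end Contract

/-! ### Wirings between two families of legs -/

section Wiring

variable {C a b r m n : ℕ} {P Q R S : Type*}

/-- The legs `Fin n`, split into the contracted ones `π(1), …, π(C)` and the `b` uncontracted ones,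
which are enumerated in increasing order. -/
noncomputable def splitEnum (π : Fin C ↪ Fin n) (h : (uncontracted π).card = b) :
    Fin C ⊕ Fin b ≃ Fin n :=
  (Equiv.sumCongr (Equiv.refl _) ((uncontracted π).orderIsoOfFin h).toEquiv).trans (splitLegs π)

theorem splitEnum_inl (π : Fin C ↪ Fin n) (h : (uncontracted π).card = b) (c : Fin C) :
    splitEnum π h (Sum.inl c) = π c := rfl

theorem splitEnum_inr (π : Fin C ↪ Fin n) (h : (uncontracted π).card = b) (j : Fin b) :
    splitEnum π h (Sum.inr j) = (uncontracted π).orderEmbOfFin h j := rfl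

/-- The pattern in which `C` of the legs `P` are joined to legs in `R`, the other legs in `P` are
joined to legs in `S`, the other legs in `R` to legs in `Q`, and the remaining `r` legs of `Q` and
of `S` to each other. -/
def wiring (e : Fin C ⊕ Fin b ≃ P) (e' : Fin C ⊕ Fin a ≃ R) (d : Fin a ⊕ Fin r ≃ Q)
    (d' : Fin b ⊕ Fin r ≃ S) : P ⊕ Q ≃ R ⊕ S :=
  (Equiv.sumCongr e d).symm.trans
    ((Equiv.sumSumSumComm (Fin C) (Fin b) (Fin a) (Fin r)).trans (Equiv.sumCongr e' d'))

theorem wiring_eq_iff {e : Fin C ⊕ Fin b ≃ P} {e' : Fin C ⊕ Fin a ≃ R} {d : Fin a ⊕ Fin r ≃ Q}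
    {d' : Fin b ⊕ Fin r ≃ S} {θ : P ⊕ Q ≃ R ⊕ S} :
    wiring e e' d d' = θ ↔ (∀ c, θ (Sum.inl (e (Sum.inl c))) = Sum.inl (e' (Sum.inl c))) ∧
      (∀ j, θ (Sum.inl (e (Sum.inr j))) = Sum.inr (d' (Sum.inl j))) ∧
      (∀ i, θ (Sum.inr (d (Sum.inl i))) = Sum.inl (e' (Sum.inr i))) ∧
      ∀ s, θ (Sum.inr (d (Sum.inr s))) = Sum.inr (d' (Sum.inr s)) := by
  constructor
  · rintro rfl
    simp [wiring]
  · rintro ⟨h1, h2, h3, h4⟩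
    refine Equiv.ext fun x => ?_
    obtain ⟨y, rfl⟩ := (Equiv.sumCongr e d).surjective x
    rcases y with (c | j) | (i | s)
    · simpa [wiring] using (h1 c).symm
    · simpa [wiring] using (h2 j).symm
    · simpa [wiring] using (h3 i).symm
    · simpa [wiring] using (h4 s).symm

/-- The legs in `P` that a wiring joins to legs in `R`. -/
def joined [Fintype P] (θ : P ⊕ Q ≃ R ⊕ S) : Finset P :=
  Finset.univ.filter fun j => (θ (Sum.inl j)).isLeft

theorem mem_joined [Fintype P] {θ : P ⊕ Q ≃ R ⊕ S} {j : P} :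
    j ∈ joined θ ↔ ∃ i, θ (Sum.inl j) = Sum.inl i := by
  simp [joined, Sum.isLeft_iff]

theorem joined_wiring (π : Fin C ↪ Fin n) (h : (uncontracted π).card = b)
    (e' : Fin C ⊕ Fin a ≃ R) (d : Fin a ⊕ Fin r ≃ Q) (d' : Fin b ⊕ Fin r ≃ S) :
    joined (wiring (splitEnum π h) e' d d') = Finset.univ.map π := by
  obtain ⟨h1, h2, -, -⟩ := wiring_eq_iff.1 (rfl : wiring (splitEnum π h) e' d d' = _)
  ext j
  obtain ⟨c | k, rfl⟩ := (splitEnum π h).surjective j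
  · rw [mem_joined, h1]
    simp [splitEnum_inl]
  · rw [mem_joined, h2]
    have := (mem_uncontracted π _).1 ((uncontracted π).orderEmbOfFin_mem h k)
    simpa [splitEnum_inr] using this

theorem strictAnti_eq_of_map_eq {π ρ : Fin C ↪ Fin n} (hπ : StrictAnti π) (hρ : StrictAnti ρ)
    (h : Finset.univ.map π = Finset.univ.map ρ) : π = ρ := by
  have hc : (Finset.univ.map ρ).card = C := by simp
  have key : ∀ σ : Fin C ↪ Fin n, StrictAnti σ → Finset.univ.map σ = Finset.univ.map ρ →
      (fun c => σ c.rev) = (Finset.univ.map ρ).orderEmbOfFin hc := fun σ hσ hσρ =>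
    Finset.orderEmbOfFin_unique hc (fun c => by rw [← hσρ]; simp)
      fun i j hij => hσ (Fin.rev_lt_rev.2 hij)
  have := (key π hπ h).trans (key ρ hρ rfl).symm
  ext c
  simpa using congrArg Fin.val (congrFun this c.rev)

theorem card_uncontracted_of_add (π : Fin C ↪ Fin n) (h : C + b = n) :
    (uncontracted π).card = b := by
  rw [card_uncontracted]; omega

/-- Every wiring comes from a contraction configuration. -/
theorem exists_wiring_eq {kA kB : ℕ} (hb : C + b = n) (ha : C + a = m) (hkB : a + r = kB)
    (hkA : b + r = kA) (θ : Fin n ⊕ Fin kB ≃ Fin m ⊕ Fin kA) (hθ : (joined θ).card = C) :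
    ∃ (π : Fin C ↪ Fin n) (π' : Fin C ↪ Fin m) (d : Fin a ⊕ Fin r ≃ Fin kB)
      (d' : Fin b ⊕ Fin r ≃ Fin kA), StrictAnti π ∧
      wiring (splitEnum π (card_uncontracted_of_add π hb))
        (splitEnum π' (card_uncontracted_of_add π' ha)) d d' = θ := by
  -- `π` lists the joined legs in decreasing order, and `π'` lists their partners
  let π : Fin C ↪ Fin n := Fin.revPerm.toEmbedding.trans ((joined θ).orderEmbOfFin hθ).toEmbedding
  have hπ : StrictAnti π := fun i j hij =>
    ((joined θ).orderEmbOfFin hθ).strictMono (Fin.rev_lt_rev.2 hij)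
  have hmap : Finset.univ.map π = joined θ := by
    rw [← Finset.map_map]
    simp
  have hmem : ∀ j, j ∈ joined θ ↔ ∃ c, π c = j := fun j => by rw [← hmap]; simp
  have hl : ∀ c, ∃ i, θ (Sum.inl (π c)) = Sum.inl i := fun c => mem_joined.1 ((hmem _).2 ⟨c, rfl⟩)
  choose p' hp' using hl
  let π' : Fin C ↪ Fin m := ⟨p', fun c c' h => π.injective (Sum.inl_injective
    (θ.injective (by rw [hp', hp', h])))⟩
  set e := splitEnum π (card_uncontracted_of_add π hb) with he
  set e' := splitEnum π' (card_uncontracted_of_add π' ha) with he'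
  have h1 : ∀ c, θ (Sum.inl (e (Sum.inl c))) = Sum.inl (e' (Sum.inl c)) := hp'
  -- the other legs in `Fin m` have their partners in `Fin kB`; these partners start off `d`, and
  -- the rest of `Fin kB` is enumerated in any way
  have hq : ∀ i : Fin a, ∃ x, θ (Sum.inr x) = Sum.inl (e' (Sum.inr i)) := by
    intro i
    obtain ⟨j | x, hy⟩ := θ.surjective (Sum.inl (e' (Sum.inr i)))
    · obtain ⟨c, rfl⟩ := (hmem j).1 (mem_joined.2 ⟨_, hy⟩)
      have := e'.injective (Sum.inl_injective (hy.symm.trans (h1 c)))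
      simp at this
    · exact ⟨x, hy⟩
  choose q hq using hq
  let ε : Fin a ↪ Fin kB := ⟨q, fun i i' h => by
    have := e'.injective (Sum.inl_injective ((hq i).symm.trans ((congrArg (fun x => θ (Sum.inr x))
      h).trans (hq i'))))
    simpa using this⟩
  set d := splitEnum ε (card_uncontracted_of_add ε hkB) with hd
  have h3 : ∀ i, θ (Sum.inr (d (Sum.inl i))) = Sum.inl (e' (Sum.inr i)) := hq
  -- `d'` is what `θ` forces on the other legs in `Fin n` and on the rest of `Fin kB`
  have ht : ∀ j : Fin b, ∃ x, θ (Sum.inl (e (Sum.inr j))) = Sum.inr x := by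
    intro j
    rcases hx : θ (Sum.inl (e (Sum.inr j))) with y | x
    · obtain ⟨c, hc⟩ := (hmem _).1 (mem_joined.2 ⟨_, hx⟩)
      have := e.injective (show e (Sum.inl c) = e (Sum.inr j) from hc)
      simp at this
    · exact ⟨x, rfl⟩
  choose t ht using ht
  have hu : ∀ s : Fin r, ∃ x, θ (Sum.inr (d (Sum.inr s))) = Sum.inr x := by
    intro s
    rcases hx : θ (Sum.inr (d (Sum.inr s))) with y | x
    · exfalso
      obtain ⟨c | i, rfl⟩ := e'.surjective y
      · have := θ.injective (hx.trans (h1 c).symm)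
        simp at this
      · have := d.injective (Sum.inr_injective (θ.injective (hx.trans (h3 i).symm)))
        simp at this
    · exact ⟨x, rfl⟩
  choose u hu using hu
  have hinj : Function.Injective (Sum.elim t u) := by
    have hrw : ∀ z, Sum.inr (Sum.elim t u z) =
        θ (Sum.elim (fun j => Sum.inl (e (Sum.inr j))) (fun s => Sum.inr (d (Sum.inr s))) z) := by
      rintro (j | s)
      · exact (ht j).symm
      · exact (hu s).symm
    intro z z' h
    have := θ.injective ((hrw z).symm.trans ((congrArg Sum.inr h).trans (hrw z')))
    rcases z with j | s <;> rcases z' with j' | s' <;> simp at this ⊢ <;> exact this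
  let d' : Fin b ⊕ Fin r ≃ Fin kA := Equiv.ofBijective (Sum.elim t u)
    ((Fintype.bijective_iff_injective_and_card _).2 ⟨hinj, by simp [hkA]⟩)
  exact ⟨π, π', d, d', hπ, wiring_eq_iff.2 ⟨h1, ht, h3, hu⟩⟩

theorem wiring_relabel_rest (e : Fin C ⊕ Fin b ≃ P) (e' : Fin C ⊕ Fin a ≃ R)
    (d : Fin a ⊕ Fin r ≃ Q) (d' : Fin b ⊕ Fin r ≃ S) (γ : Equiv.Perm (Fin r)) :
    wiring e e' ((Equiv.sumCongr (Equiv.refl _) γ).trans d)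
      ((Equiv.sumCongr (Equiv.refl _) γ).trans d') = wiring e e' d d' := by
  obtain ⟨h1, h2, h3, h4⟩ := wiring_eq_iff.1 (rfl : wiring e e' d d' = _)
  exact wiring_eq_iff.2 ⟨h1, h2, h3, fun s => h4 (γ s)⟩

/-- Two presentations of the same wiring by contraction configurations differ by a permutation of
the `r` legs that take no part in the contraction. -/
theorem exists_perm_of_wiring_eq {kA kB : ℕ} {π ρ : Fin C ↪ Fin n} {π' ρ' : Fin C ↪ Fin m}
    {d ε : Fin a ⊕ Fin r ≃ Fin kB} {d' ε' : Fin b ⊕ Fin r ≃ Fin kA}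
    (hπ : StrictAnti π) (hρ : StrictAnti ρ)
    (hb : C + b = n) (ha : C + a = m)
    (h : wiring (splitEnum π (card_uncontracted_of_add π hb))
        (splitEnum π' (card_uncontracted_of_add π' ha)) d d' =
      wiring (splitEnum ρ (card_uncontracted_of_add ρ hb))
        (splitEnum ρ' (card_uncontracted_of_add ρ' ha)) ε ε') :
    π = ρ ∧ π' = ρ' ∧ ∃ γ : Equiv.Perm (Fin r), d = (Equiv.sumCongr (Equiv.refl _) γ).trans ε ∧
      d' = (Equiv.sumCongr (Equiv.refl _) γ).trans ε' := by
  have hπρ : π = ρ := strictAnti_eq_of_map_eq hπ hρ (by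
    rw [← joined_wiring π (card_uncontracted_of_add π hb), h, joined_wiring])
  subst hπρ
  set e := splitEnum π (card_uncontracted_of_add π hb)
  obtain ⟨h1, h2, h3, h4⟩ := wiring_eq_iff.1 h
  obtain ⟨g1, g2, g3, g4⟩ := wiring_eq_iff.1 (rfl : wiring e
    (splitEnum ρ' (card_uncontracted_of_add ρ' ha)) ε ε' = _)
  have hπρ' : π' = ρ' := by
    ext c
    exact congrArg Fin.val (Sum.inl_injective ((h1 c).symm.trans (g1 c)))
  subst hπρ'
  refine ⟨rfl, rfl, ?_⟩
  have hl : ∀ i, d (Sum.inl i) = ε (Sum.inl i) := fun i =>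
    Sum.inr_injective (Equiv.injective _ ((h3 i).trans (g3 i).symm))
  have hδ : ∀ i, (d.trans ε.symm) (Sum.inl i) = Sum.inl i := fun i => by simp [hl]
  obtain ⟨⟨γ₁, γ⟩, hγ⟩ := Equiv.Perm.mem_sumCongrHom_range_of_perm_mapsTo_inl
    (σ := d.trans ε.symm) (by rintro _ ⟨i, rfl⟩; exact ⟨i, (hδ i).symm⟩)
  have hs : ∀ s, d (Sum.inr s) = ε (Sum.inr (γ s)) := fun s => by
    have := congrArg (fun σ => ε (σ (Sum.inr s))) hγ
    simpa using this.symm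
  refine ⟨γ, ?_, ?_⟩
  · ext (i | s)
    · simp [hl]
    · simp [hs]
  · ext (j | s)
    · have := Sum.inr_injective ((h2 j).symm.trans (g2 j))
      simp [this]
    · have := h4 s
      rw [hs, g4] at this
      simp [Sum.inr_injective this]

/-- A sum over the wirings with `C` joined legs is a sum over the configurations of `C`
contractions and over the placements of the uncontracted legs; each wiring is met `r!` times. -/
theorem factorial_smul_sum_wirings {kA kB : ℕ} {V : Type*} [AddCommMonoid V] (hb : C + b = n)
    (ha : C + a = m) (hkB : a + r = kB) (hkA : b + r = kA)
    (g : (Fin n ⊕ Fin kB ≃ Fin m ⊕ Fin kA) → V) :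
    r.factorial • ∑ θ with (joined θ).card = C, g θ =
      ∑ π : {π : Fin C ↪ Fin n // StrictAnti π}, ∑ π' : Fin C ↪ Fin m,
        ∑ d : Fin a ⊕ Fin r ≃ Fin kB, ∑ d' : Fin b ⊕ Fin r ≃ Fin kA,
          g (wiring (splitEnum π.1 (card_uncontracted_of_add π.1 hb))
            (splitEnum π' (card_uncontracted_of_add π' ha)) d d') := by
  classical
  let w : ({π : Fin C ↪ Fin n // StrictAnti π} × (Fin C ↪ Fin m)) ×
      ((Fin a ⊕ Fin r ≃ Fin kB) × (Fin b ⊕ Fin r ≃ Fin kA)) →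
      (Fin n ⊕ Fin kB ≃ Fin m ⊕ Fin kA) := fun q =>
    wiring (splitEnum q.1.1.1 (card_uncontracted_of_add q.1.1.1 hb))
      (splitEnum q.1.2 (card_uncontracted_of_add q.1.2 ha)) q.2.1 q.2.2
  have hw : ∀ q ∈ Finset.univ, w q ∈ Finset.univ.filter fun θ => (joined θ).card = C := by
    intro q _
    simp [w, joined_wiring]
  have hsum : ∑ q, g (w q) = r.factorial • ∑ θ with (joined θ).card = C, g θ := by
    rw [← Finset.sum_fiberwise_of_maps_to hw, Finset.smul_sum]
    refine Finset.sum_congr rfl fun θ hθ => ?_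
    rw [Finset.sum_congr rfl (g := fun _ => g θ) (by simp +contextual), Finset.sum_const]
    congr 1
    obtain ⟨π, π', d, d', hπ, hq⟩ := exists_wiring_eq hb ha hkB hkA θ (by simpa using hθ)
    rw [show r.factorial = (Finset.univ : Finset (Equiv.Perm (Fin r))).card by
      simp [Finset.card_univ, Fintype.card_perm]]
    symm
    refine Finset.card_bij (fun γ _ => ((⟨π, hπ⟩, π'),
      ((Equiv.sumCongr (Equiv.refl _) γ).trans d, (Equiv.sumCongr (Equiv.refl _) γ).trans d')))
      ?_ ?_ ?_
    · intro γ _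
      simpa [w, wiring_relabel_rest] using hq
    · intro γ _ γ' _ h
      simp only [Prod.mk.injEq, true_and] at h
      ext s
      have := congrArg (fun δ => d.symm (δ (Sum.inr s))) h.1
      simpa using congrArg (Sum.elim (fun _ => 0) Fin.val) this
    · rintro ⟨⟨⟨ρ, hρ⟩, ρ'⟩, ⟨ε, ε'⟩⟩ hy
      have hy' : w ⟨⟨⟨ρ, hρ⟩, ρ'⟩, ⟨ε, ε'⟩⟩ = θ := by simpa using hy
      obtain ⟨rfl, rfl, γ, rfl, rfl⟩ := exists_perm_of_wiring_eq hρ hπ hb ha (hy'.trans hq.symm)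
      exact ⟨γ, Finset.mem_univ _, rfl⟩
  rw [← hsum, Fintype.sum_prod_type, Fintype.sum_prod_type]
  simp only [Fintype.sum_prod_type, w]

end Wiring

/-! ### Signs -/

section Signs

variable {C a b r n m : ℕ}

theorem val_finRotate_pow (N k : ℕ) (i : Fin N) : (((finRotate N) ^ k) i : ℕ) = (i + k) % N := by
  induction k with
  | zero => simp [Nat.mod_eq_of_lt i.isLt]
  | succ k ih =>
    have := i.neZero
    rw [pow_succ', Equiv.Perm.mul_apply, finRotate_apply, Fin.val_add, ih, Fin.coe_ofNat_eq_mod,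
      ← Nat.add_mod, add_assoc]

/-- Moving a block of length `b` past a block of length `a` has the sign `(-1)^(ab)`. -/
theorem sign_finRotate_pow (b a : ℕ) :
    Equiv.Perm.sign (finRotate (b + a) ^ a) = (-1) ^ (a * b) := by
  rw [map_pow, sign_finRotate, ← pow_mul]
  rcases Nat.eq_zero_or_pos a with rfl | ha
  · simp
  obtain ⟨a, rfl⟩ : ∃ k, a = k + 1 := ⟨a - 1, by omega⟩
  rw [show b + (a + 1) - 1 = b + a by omega, add_mul, pow_add,
    show a * (a + 1) = 2 * (a * (a + 1) / 2) by
      have := Nat.even_mul_succ_self a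
      obtain ⟨k, hk⟩ := this
      omega,
    pow_mul _ 2, neg_one_sq, one_pow, mul_one, mul_comm]

/-- The maximally crossed position: the contracted legs come last, in reversed order, the
uncontracted ones come first. -/
def crossed (C b : ℕ) {n : ℕ} (h : C + b = n) : Fin C ⊕ Fin b ≃ Fin n :=
  (((Equiv.sumCongr Fin.revPerm (Equiv.refl (Fin b))).trans (Equiv.sumComm _ _)).trans
    finSumFinEquiv).trans (finCongr ((add_comm b C).trans h))

theorem crossed_inl (h : C + b = n) (c : Fin C) :
    (crossed C b h (Sum.inl c) : ℕ) = n - 1 - c := by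
  simp [crossed, Fin.val_rev]
  omega

theorem crossed_inr (h : C + b = n) (j : Fin b) : (crossed C b h (Sum.inr j) : ℕ) = j := by
  simp [crossed]

theorem crossing_eq (π : Fin C ↪ Fin n) (h : C + b = n) :
    crossing π = (splitEnum π (card_uncontracted_of_add π h)).symm.trans (crossed C b h) := by
  set e := splitEnum π (card_uncontracted_of_add π h) with he
  refine (existsUnique_isCrossing π).unique (crossing_spec π) ⟨fun c => ?_, ?_⟩
  · have : e.symm (π c) = Sum.inl c := e.symm_apply_apply (Sum.inl c)
    rw [Equiv.trans_apply, this, crossed_inl]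
    omega
  · have hj : ∀ j ∈ uncontracted π, ∃ i, e (Sum.inr i) = j := by
      intro j hj
      obtain ⟨c | i, rfl⟩ := e.surjective j
      · exact absurd rfl ((mem_uncontracted π _).1 hj c)
      · exact ⟨i, rfl⟩
    intro j h1 k h2 hjk
    obtain ⟨i, rfl⟩ := hj j h1
    obtain ⟨i', rfl⟩ := hj k h2
    rw [Equiv.trans_apply, Equiv.trans_apply, Equiv.symm_apply_apply, Equiv.symm_apply_apply,
      Fin.lt_def, crossed_inr, crossed_inr]
    exact ((uncontracted π).orderEmbOfFin (card_uncontracted_of_add π h)).lt_iff_lt.1 hjk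

/-- If all legs are in the standard position, the wiring moves the `b` uncontracted creation legs
past the `a` uncontracted annihilation legs, and leaves all other places alone. -/
theorem sign_wiring_crossed {N kA kB : ℕ} (hb : C + b = n) (ha : C + a = m) (hkB : a + r = kB)
    (hkA : b + r = kA) (hB : n + kB = N) (hA : m + kA = N) :
    Equiv.Perm.sign ((legs n kB hB).symm.trans ((wiring (crossed C b hb) (crossed C a ha)
      (legs a r hkB) (legs b r hkA)).trans (legs m kA hA))) = (-1) ^ (a * b) := by
  -- `legs` lists every family backwards, which undoes the reversal in `crossed`; so the places
  -- `0, …, C - 1` are fixed, the next two blocks of lengths `b` and `a` are exchanged, and the last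
  -- `r` places are fixed
  let β : Fin C ⊕ (Fin (b + a) ⊕ Fin r) ≃ Fin N :=
    ((Equiv.sumCongr (Equiv.refl _) finSumFinEquiv).trans finSumFinEquiv).trans
      (finCongr (by omega))
  have hβ1 : ∀ c, (β (Sum.inl c) : ℕ) = c := fun c => by simp [β]
  have hβ2 : ∀ x, (β (Sum.inr (Sum.inl x)) : ℕ) = C + x := fun x => by simp [β]
  have hβ3 : ∀ s, (β (Sum.inr (Sum.inr s)) : ℕ) = C + (b + a + s) := fun s => by simp [β]
  let ρ : Equiv.Perm (Fin C ⊕ (Fin (b + a) ⊕ Fin r)) :=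
    Equiv.sumCongr (Equiv.refl _) (Equiv.sumCongr (finRotate (b + a) ^ a) (Equiv.refl _))
  set W := wiring (crossed C b hb) (crossed C a ha) (legs a r hkB) (legs b r hkA)
  obtain ⟨h1, h2, h3, h4⟩ := wiring_eq_iff.1 (rfl : W = _)
  have key : (legs n kB hB).symm.trans (W.trans (legs m kA hA)) = (β.symm.trans ρ).trans β := by
    have hsuff : ∀ x y, (legs n kB hB x : ℕ) = β y →
        (legs m kA hA (W x) : ℕ) = β (ρ y) →
        legs m kA hA (W ((legs n kB hB).symm (legs n kB hB x))) =
          β (ρ (β.symm (legs n kB hB x))) := by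
      intro x y hx hy
      rw [Fin.ext hx, Equiv.symm_apply_apply, ← Fin.ext hx, Equiv.symm_apply_apply]
      exact Fin.ext hy
    refine Equiv.ext fun z => ?_
    obtain ⟨x, rfl⟩ := (legs n kB hB).surjective z
    obtain ⟨y, rfl⟩ := (Equiv.sumCongr (crossed C b hb) (legs a r hkB)).surjective x
    rcases y with (c | j) | (i | s)
    · refine hsuff _ (Sum.inl c) ?_ ?_
      · simp only [Equiv.sumCongr_apply, Sum.map_inl, legs_inl, crossed_inl, hβ1]
        omega
      · simp only [Equiv.sumCongr_apply, Sum.map_inl, h1, legs_inl, crossed_inl, hβ1, ρ,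
          Equiv.refl_apply]
        omega
    · refine hsuff _ (Sum.inr (Sum.inl ⟨b - 1 - j, by omega⟩)) ?_ ?_
      · simp only [Equiv.sumCongr_apply, Sum.map_inl, legs_inl, crossed_inr, hβ2]
        omega
      · simp only [Equiv.sumCongr_apply, Sum.map_inl, Sum.map_inr, h2, legs_inr, legs_inl, hβ2, ρ,
          val_finRotate_pow]
        rw [Nat.mod_eq_of_lt (by omega)]
        omega
    · refine hsuff _ (Sum.inr (Sum.inl ⟨b + (a - 1 - i), by omega⟩)) ?_ ?_
      · simp only [Equiv.sumCongr_apply, Sum.map_inr, legs_inl, legs_inr, hβ2]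
        omega
      · simp only [Equiv.sumCongr_apply, Sum.map_inl, Sum.map_inr, h3, legs_inl, crossed_inr, hβ2,
          ρ, val_finRotate_pow]
        rw [show b + (a - 1 - (i : ℕ)) + a = (a - 1 - i) + (b + a) by omega, Nat.add_mod_right,
          Nat.mod_eq_of_lt (by omega)]
        omega
    · refine hsuff _ (Sum.inr (Sum.inr s)) ?_ ?_
      · simp only [Equiv.sumCongr_apply, Sum.map_inr, legs_inr, hβ3]
        omega
      · simp only [Equiv.sumCongr_apply, Sum.map_inr, h4, legs_inr, hβ3, ρ, Equiv.refl_apply]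
        omega
  rw [key, Equiv.Perm.sign_symm_trans_trans, ← sign_finRotate_pow b a]
  simp only [ρ, Equiv.Perm.sign_sumCongr]
  simp

theorem sign_sumCongr_conj {P Q : Type*} [Fintype P] [DecidableEq P] [Fintype Q] [DecidableEq Q]
    {N : ℕ} (l : P ⊕ Q ≃ Fin N) (p : Equiv.Perm P) (q : Equiv.Perm Q) :
    Equiv.Perm.sign ((l.symm.trans (Equiv.sumCongr p q)).trans l) =
      Equiv.Perm.sign p * Equiv.Perm.sign q := by
  rw [Equiv.Perm.sign_symm_trans_trans]
  exact Equiv.Perm.sign_sumCongr p q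

theorem sign_symm_trans_comm {P : Type*} [Fintype P] {N : ℕ} (x y : P ≃ Fin N) :
    Equiv.Perm.sign (x.symm.trans y) = Equiv.Perm.sign (y.symm.trans x) := by
  rw [← Equiv.Perm.sign_inv]
  rfl

/-- The sign of a wiring, as a permutation of places: one factor for each family of legs, which
compares it with its standard position, and the sign of the wiring of the standard positions. -/
theorem sign_wiring {N kA kB : ℕ} (hb : C + b = n) (ha : C + a = m) (hkB : a + r = kB)
    (hkA : b + r = kA) (hB : n + kB = N) (hA : m + kA = N) (e : Fin C ⊕ Fin b ≃ Fin n)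
    (e' : Fin C ⊕ Fin a ≃ Fin m) (d : Fin a ⊕ Fin r ≃ Fin kB) (d' : Fin b ⊕ Fin r ≃ Fin kA) :
    Equiv.Perm.sign ((legs n kB hB).symm.trans ((wiring e e' d d').trans (legs m kA hA))) =
      (-1) ^ (a * b) * Equiv.Perm.sign (e.symm.trans (crossed C b hb)) *
        Equiv.Perm.sign (e'.symm.trans (crossed C a ha)) *
        (Equiv.Perm.sign (d.symm.trans (legs a r hkB)) *
          Equiv.Perm.sign (d'.symm.trans (legs b r hkA))) := by
  set e₀ := crossed C b hb
  set e₀' := crossed C a ha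
  set d₀ := legs a r hkB
  set d₀' := legs b r hkA
  set lB := legs n kB hB
  set lA := legs m kA hA
  have h : lB.symm.trans ((wiring e e' d d').trans lA) =
      ((lB.symm.trans (Equiv.sumCongr (e.symm.trans e₀) (d.symm.trans d₀))).trans lB).trans
        ((lB.symm.trans ((wiring e₀ e₀' d₀ d₀').trans lA)).trans
          ((lA.symm.trans (Equiv.sumCongr (e₀'.symm.trans e') (d₀'.symm.trans d'))).trans lA)) := by
    refine Equiv.ext fun z => ?_
    simp only [Equiv.trans_apply, Equiv.symm_apply_apply]
    congr 1
    obtain ⟨y, hy⟩ := (Equiv.sumCongr e d).surjective (lB.symm z)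
    rw [← hy]
    rcases y with (c | j) | (i | s) <;> simp [wiring]
  rw [h, ← Equiv.Perm.mul_def, ← Equiv.Perm.mul_def, map_mul, map_mul, sign_sumCongr_conj,
    sign_sumCongr_conj, sign_wiring_crossed hb ha hkB hkA hB hA, sign_symm_trans_comm e₀',
    sign_symm_trans_comm d₀']
  ac_rfl

end Signs

/-! ### Contracted kernels -/

section ConfigKernel

variable {X : Type*} [MeasurableSpace X] {μ : Measure X} [SigmaFinite μ]
  {ι P Q R S l τ : Type*} [Fintype ι] [Fintype P] [Fintype Q] [Fintype R] [Fintype S] [Fintype l]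
  [Fintype τ] {C a b r nA mA nB mB : ℕ}

/-- The contraction of `f` with `g` in which the leg `e' c` of `f` is joined to the leg `e c` of
`g`, and the other legs are enumerated by `e'` and `e`. -/
noncomputable def joinKernel (e : Fin C ⊕ Fin b ≃ P) (e' : Fin C ⊕ Fin a ≃ R)
    (f : Tens μ (ι ⊕ R)) (g : Tens μ (P ⊕ l)) : Tens μ ((ι ⊕ Fin a) ⊕ (Fin b ⊕ l)) :=
  contract
    (relabel (((Equiv.refl ι).sumCongr (e'.symm.trans (Equiv.sumComm _ _))).trans
      (Equiv.sumAssoc _ _ _).symm) f)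
    (relabel ((e.symm.sumCongr (Equiv.refl l)).trans (Equiv.sumAssoc _ _ _)) g)

/-- The kernel `joinKernel`, with its creation and annihilation legs in the order of `:AB:`. -/
noncomputable def configKernel (e : Fin C ⊕ Fin b ≃ Fin nB) (e' : Fin C ⊕ Fin a ≃ Fin mA)
    (fA : Tens μ (Fin nA ⊕ Fin mA)) (fB : Tens μ (Fin nB ⊕ Fin mB)) :
    Tens μ (Fin (b + nA) ⊕ Fin (a + mB)) :=
  relabel ((Equiv.sumSumSumComm _ _ _ _).trans (Equiv.sumCongr
    ((Equiv.sumComm _ _).trans finSumFinEquiv) finSumFinEquiv)) (joinKernel e e' fA fB)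

theorem contract_relabel_wiring (e : Fin C ⊕ Fin b ≃ P) (e' : Fin C ⊕ Fin a ≃ R)
    (d : Fin a ⊕ Fin r ≃ Q) (d' : Fin b ⊕ Fin r ≃ S)
    (f : Tens μ (ι ⊕ R)) (g : Tens μ (P ⊕ l)) (Φ : Tens μ (l ⊕ Q)) :
    contract f (relabel (wiring e e' d d') (contract g Φ)) =
      relabel ((Equiv.sumAssoc _ _ _).trans ((Equiv.refl ι).sumCongr d'))
        (contract (relabel (Equiv.sumSumSumComm _ _ _ _) (joinKernel e e' f g))
          (relabel (((Equiv.refl l).sumCongr d.symm).trans ((Equiv.sumAssoc _ _ _).symm.trans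
            ((Equiv.sumComm _ _).sumCongr (Equiv.refl _)))) Φ)) := by
  have hf : f = relabel ((Equiv.refl ι).sumCongr e') (relabel ((Equiv.refl ι).sumCongr e'.symm) f) := by
    rw [relabel_relabel, Equiv.sumCongr_trans]
    simp [relabel_refl]
  have hw : relabel (wiring e e' d d') (contract g Φ) = relabel (e'.sumCongr d')
      (relabel (Equiv.sumSumSumComm _ _ _ _) (contract
        (relabel (e.symm.sumCongr (Equiv.refl l)) g)
        (relabel ((Equiv.refl l).sumCongr d.symm) Φ))) := by
    rw [contract_relabel, relabel_relabel, relabel_relabel]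
    rfl
  rw [hw]
  conv_lhs => rw [hf]
  rw [contract_relabel, contract_assoc, relabel_relabel, relabel_relabel, relabel_relabel,
    relabel_relabel]
  have he : ((Equiv.refl ι).sumCongr e'.symm).trans (((Equiv.refl ι).sumCongr
      (Equiv.sumComm (Fin C) (Fin a))).trans (Equiv.sumAssoc ι (Fin a) (Fin C)).symm) =
      ((Equiv.refl ι).sumCongr (e'.symm.trans (Equiv.sumComm _ _))).trans
        (Equiv.sumAssoc _ _ _).symm := by
    refine Equiv.ext ?_
    rintro (i | i) <;> rfl
  rw [he]
  rfl

/-- For configurations of contractions, `configKernel` is the kernel of the contribution. -/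
theorem contribution_eq (π : Fin C ↪ Fin nB) (π' : Fin C ↪ Fin mA)
    (hb : (uncontracted π).card = b) (ha : (uncontracted π').card = a)
    (fA : Tens μ (Fin nA ⊕ Fin mA)) (fB : Tens μ (Fin nB ⊕ Fin mB)) :
    contribution π π' fA fB =
      smear (b + nA) (a + mB) (configKernel (splitEnum π hb) (splitEnum π' ha) fA fB) := by
  subst hb ha
  have h : joinKernel (splitEnum π rfl) (splitEnum π' rfl) fA fB =
      relabel (((Equiv.refl _).sumCongr (enumLegs π').symm).sumCongr
        ((enumLegs π).symm.sumCongr (Equiv.refl _))) (contractedKernel π π' fA fB) := by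
    rw [contractedKernel, ← contract_relabel _ (Equiv.refl (Fin C)), relabel_relabel,
      relabel_relabel, joinKernel]
    congr 2
    · congr 2
      ext (i | i)
      · rfl
      · simp only [splitEnum]
        rcases h : (splitLegs π').symm i with c | j
        · simp [h]
        · simp [h]
          rfl
    · congr 1
      ext (i | i)
      · simp only [splitEnum]
        rcases h : (splitLegs π).symm i with c | j
        · simp [h]
        · simp [h]
          rfl
      · rfl
  rw [configKernel, h, relabel_relabel, contribution]
  congr 2
  have he : ∀ u v : (Fin nA ⊕ {j // j ∈ uncontracted π'}) ⊕ ({j // j ∈ uncontracted π} ⊕ Fin mB) ≃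
      Fin ((uncontracted π).card + nA) ⊕ Fin ((uncontracted π').card + mB),
      (∀ x, u x = v x) → relabel (μ := μ) u = relabel v := fun u v huv => by rw [Equiv.ext huv]
  rw [he]
  rintro ((i | i) | (i | i)) <;> rfl

theorem contract_empty (f : Tens μ ι) (g : Tens μ τ) :
    contract (relabel (Equiv.sumEmpty ι (Fin 0)).symm f)
      (relabel (Equiv.emptySum (Fin 0) τ).symm g) = tensor f g := by
  have hpr : IsProbabilityMeasure (Measure.pi fun _ : Fin 0 => μ) := by
    rw [Measure.pi_of_empty (fun _ : Fin 0 => μ) (fun i => i.elim0)]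
    infer_instance
  refine Lp.ext ?_
  filter_upwards [contract_coe (relabel (Equiv.sumEmpty ι (Fin 0)).symm f)
      (relabel (Equiv.emptySum (Fin 0) τ).symm g), tensor_coe f g,
    contractFun_congr (relabel_coe (Equiv.sumEmpty ι (Fin 0)).symm f)
      (relabel_coe (Equiv.emptySum (Fin 0) τ).symm g)] with w h1 h2 h3
  rw [h1, h2, contractFun, integral_congr_ae (g := fun _ => f (w ∘ Sum.inl) * g (w ∘ Sum.inr))]
  · simp
  · filter_upwards [h3] with y hy
    rw [hy.1, hy.2]
    rfl

/-- A configuration without contractions contributes the normal ordered product. -/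
theorem contribution_zero (π : Fin 0 ↪ Fin nB) (π' : Fin 0 ↪ Fin mA)
    (fA : Tens μ (Fin nA ⊕ Fin mA)) (fB : Tens μ (Fin nB ⊕ Fin mB)) :
    contribution π π' fA fB = normalOrdered fA fB := by
  have hs : ∀ {n : ℕ} (ρ : Fin 0 ↪ Fin n), splitEnum ρ (card_uncontracted_of_add ρ (zero_add n)) =
      Equiv.emptySum (Fin 0) (Fin n) := by
    intro n ρ
    ext (i | j)
    · exact i.elim0
    · have hj : (fun j => j) = (uncontracted ρ).orderEmbOfFin
          (card_uncontracted_of_add ρ (zero_add n)) :=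
        Finset.orderEmbOfFin_unique _ (fun j => (mem_uncontracted ρ j).2 fun c => c.elim0)
          strictMono_id
      rw [splitEnum_inr, ← hj]
      rfl
  rw [contribution_eq π π' (card_uncontracted_of_add π (zero_add nB))
    (card_uncontracted_of_add π' (zero_add mA)), hs, hs, normalOrdered, configKernel]
  congr 2
  rw [← contract_empty, joinKernel]
  congr 2
  · congr 2
    ext (i | i) <;> rfl
  · congr 1
    ext (i | i) <;> rfl

theorem crossing_zero {n : ℕ} (π : Fin 0 ↪ Fin n) : crossing π = 1 :=
  (existsUnique_isCrossing π).unique (crossing_spec π)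
    ⟨fun c => c.elim0, fun _ _ _ _ h => h⟩

end ConfigKernel

/-! ### The product of two operators, sector by sector -/

section Sectors

variable {X : Type*} [MeasurableSpace X] {μ : Measure X} [SigmaFinite μ]
  {T : Type*} [Fintype T] {C a b r nA mA nB mB kA kB N M L : ℕ}

theorem relabel_nParticle (u v : Fin N ≃ T) (Ψ : NParticle μ N) :
    relabel u (Ψ : Tens μ (Fin N)) =
      ((Equiv.Perm.sign (u.trans v.symm) : ℤ) : ℂ) • relabel v (Ψ : Tens μ (Fin N)) := by
  have h : u = (u.trans v.symm).trans v := by ext; simp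
  conv_lhs => rw [h, ← relabel_relabel, ← antisymm_coe, relabel_antisymm, antisymm_coe, map_smul]

theorem antisymm_relabel_equiv (u v : T ≃ Fin M) (F : Tens μ T) :
    antisymm M (relabel u F) =
      ((Equiv.Perm.sign (v.symm.trans u) : ℤ) : ℂ) • antisymm M (relabel v F) := by
  have h : u = v.trans (v.symm.trans u) := by ext; simp
  conv_lhs => rw [h, ← relabel_relabel, antisymm_relabel]

/-- A wiring of `fA` with `fB` and `Ψ` depends on the placements `d` and `d'` of the uncontracted
legs only through their signs, since `Ψ` and the image of `S₋` are antisymmetric. -/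
theorem antisymm_contract_wiring (hkB : a + r = kB) (hkA : b + r = kA) (hN : mB + kB = N)
    (hM : nA + kA = M) (hN' : a + mB + r = N) (hM' : b + nA + r = M)
    (e : Fin C ⊕ Fin b ≃ Fin nB) (e' : Fin C ⊕ Fin a ≃ Fin mA) (d : Fin a ⊕ Fin r ≃ Fin kB)
    (d' : Fin b ⊕ Fin r ≃ Fin kA) (fA : Tens μ (Fin nA ⊕ Fin mA)) (fB : Tens μ (Fin nB ⊕ Fin mB))
    (Ψ : NParticle μ N) :
    antisymm M (relabel (legs nA kA hM) (contract fA (relabel (wiring e e' d d')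
      (contract fB (relabel (legs mB kB hN).symm (Ψ : Tens μ (Fin N))))))) =
    (((Equiv.Perm.sign (d.symm.trans (legs a r hkB)) *
      Equiv.Perm.sign (d'.symm.trans (legs b r hkA)) : ℤˣ) : ℤ) : ℂ) •
      antisymm M (relabel (legs (b + nA) r hM') (contract (configKernel e e' fA fB)
        (relabel (legs (a + mB) r hN').symm (Ψ : Tens μ (Fin N))))) := by
  set K := relabel (Equiv.sumSumSumComm _ _ _ _) (joinKernel e e' fA fB) with hK
  have hconf : configKernel e e' fA fB = relabel (Equiv.sumCongr
      ((Equiv.sumComm _ _).trans finSumFinEquiv) finSumFinEquiv) K := by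
    rw [configKernel, hK, relabel_relabel]
  have hΨ : relabel (legs (a + mB) r hN').symm (Ψ : Tens μ (Fin N)) =
      relabel ((finSumFinEquiv (m := a) (n := mB)).sumCongr (Equiv.refl (Fin r)))
        (relabel ((legs (a + mB) r hN').symm.trans
          ((finSumFinEquiv (m := a) (n := mB)).symm.sumCongr (Equiv.refl (Fin r)))) Ψ) := by
    rw [relabel_relabel, Equiv.trans_assoc, Equiv.sumCongr_trans]
    simp
  rw [contract_relabel_wiring, hconf, hΨ, contract_relabel, relabel_relabel, relabel_relabel,
    relabel_relabel,
    relabel_nParticle _ ((legs (a + mB) r hN').symm.trans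
          ((finSumFinEquiv (m := a) (n := mB)).symm.sumCongr (Equiv.refl (Fin r)))),
    map_smul, map_smul, map_smul,
    antisymm_relabel_equiv _ ((((Equiv.sumComm _ _).trans finSumFinEquiv).sumCongr
      (Equiv.refl (Fin r))).trans (legs (b + nA) r hM')), smul_smul, ← Int.cast_mul,
    ← Units.val_mul]
  have s1 : Equiv.Perm.sign (((legs mB kB hN).symm.trans
      (((Equiv.refl (Fin mB)).sumCongr d.symm).trans ((Equiv.sumAssoc _ _ _).symm.trans
        ((Equiv.sumComm _ _).sumCongr (Equiv.refl _))))).trans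
      ((legs (a + mB) r hN').symm.trans
        ((finSumFinEquiv (m := a) (n := mB)).symm.sumCongr (Equiv.refl (Fin r)))).symm) =
      Equiv.Perm.sign (d.symm.trans (legs a r hkB)) := by
    rw [← one_mul (Equiv.Perm.sign (d.symm.trans _)), ← Equiv.Perm.sign_one (α := Fin mB),
      ← sign_sumCongr_conj (legs mB kB hN)]
    congr 1
    refine Equiv.ext fun z => ?_
    obtain ⟨x, rfl⟩ := (legs mB kB hN).surjective z
    obtain ⟨y, rfl⟩ := ((Equiv.refl (Fin mB)).sumCongr d).surjective x
    apply Fin.ext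
    rcases y with i | i | i
    · simp [legs_inl]
      omega
    · simp [legs_inl, legs_inr]
      omega
    · simp [legs_inr]
      omega
  have s2 : Equiv.Perm.sign (((((Equiv.sumComm _ _).trans finSumFinEquiv).sumCongr
      (Equiv.refl (Fin r))).trans (legs (b + nA) r hM')).symm.trans
      (((Equiv.sumAssoc _ _ _).trans ((Equiv.refl (Fin nA)).sumCongr d')).trans
        (legs nA kA hM))) =
      Equiv.Perm.sign (d'.symm.trans (legs b r hkA)) := by
    rw [sign_symm_trans_comm, ← one_mul (Equiv.Perm.sign (d'.symm.trans _)),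
      ← Equiv.Perm.sign_one (α := Fin nA), ← sign_sumCongr_conj (legs nA kA hM)]
    congr 1
    refine Equiv.ext fun z => ?_
    obtain ⟨x, rfl⟩ := (legs nA kA hM).surjective z
    obtain ⟨y, rfl⟩ := ((Equiv.refl (Fin nA)).sumCongr d').surjective x
    apply Fin.ext
    rcases y with i | i | i
    · simp [legs_inl]
      omega
    · simp [legs_inl, legs_inr]
      omega
    · simp [legs_inr]
      omega
  rw [← s1, ← s2]

end Sectors

section Product

variable {X : Type*} [MeasurableSpace X] {μ : Measure X} [SigmaFinite μ]
  {C a b r nA mA nB mB kA kB N M L : ℕ}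

/-- The term of the wiring `θ` in a sector of `A B`, up to a normalization. -/
noncomputable def wiringTerm (hN : mB + kB = N) (hB : nB + kB = L) (hA : mA + kA = L)
    (hM : nA + kA = M) (fA : Tens μ (Fin nA ⊕ Fin mA)) (fB : Tens μ (Fin nB ⊕ Fin mB))
    (Ψ : NParticle μ N) (θ : Fin nB ⊕ Fin kB ≃ Fin mA ⊕ Fin kA) : Tens μ (Fin M) :=
  ((Equiv.Perm.sign ((legs nB kB hB).symm.trans (θ.trans (legs mA kA hA))) : ℤ) : ℂ) •
    antisymm M (relabel (legs nA kA hM) (contract fA (relabel θ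
      (contract fB (relabel (legs mB kB hN).symm (Ψ : Tens μ (Fin N)))))))

/-- The antisymmetrization between `A` and `B`, written out, is a sum over all wirings of the
creation legs of `B` and its spectators with the annihilation legs of `A` and its spectators. -/
theorem smearSector_smearSector (hN : mB + kB = N) (hB : nB + kB = L) (hA : mA + kA = L)
    (hM : nA + kA = M) (fA : Tens μ (Fin nA ⊕ Fin mA)) (fB : Tens μ (Fin nB ⊕ Fin mB))
    (Ψ : NParticle μ N) :
    (smearSector nA mA kA hA hM fA (smearSector nB mB kB hN hB fB Ψ) : Tens μ (Fin M)) =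
      ((√(N.factorial) * √(M.factorial) / (kA.factorial * kB.factorial) : ℝ) : ℂ) •
        ∑ θ, wiringTerm hN hB hA hM fA fB Ψ θ := by
  have hsum : ∑ θ, wiringTerm hN hB hA hM fA fB Ψ θ =
      ∑ σ : Equiv.Perm (Fin L), ((Equiv.Perm.sign σ : ℤ) : ℂ) •
        antisymm M (relabel (legs nA kA hM) (contract fA (relabel (legs mA kA hA).symm
          (relabel σ (relabel (legs nB kB hB) (contract fB (relabel (legs mB kB hN).symm Ψ))))))) := by
    refine (Fintype.sum_equiv
      (Equiv.equivCongr (legs nB kB hB).symm (legs mA kA hA).symm) _ _ fun σ => ?_).symm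
    have h : (legs nB kB hB).symm.trans ((Equiv.equivCongr (legs nB kB hB).symm
        (legs mA kA hA).symm σ).trans (legs mA kA hA)) = σ := by
      ext; simp
    rw [wiringTerm, h, relabel_relabel, relabel_relabel]
    rfl
  rw [smearSector_coe, smearSector_coe, antisymm_apply (N := L), hsum]
  simp only [map_smul, map_sum, smul_smul]
  congr 1
  rw [← Complex.ofReal_natCast, ← Complex.ofReal_inv, ← Complex.ofReal_mul, ← Complex.ofReal_mul]
  congr 1
  have hL : (0 : ℝ) < L.factorial := by exact_mod_cast L.factorial_pos
  have hkA : (0 : ℝ) < kA.factorial := by exact_mod_cast kA.factorial_pos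
  have hkB : (0 : ℝ) < kB.factorial := by exact_mod_cast kB.factorial_pos
  simp only [Real.sqrt_div' _ hkA.le, Real.sqrt_div' _ hkB.le]
  field_simp
  simp only [Real.sq_sqrt hL.le, Real.sq_sqrt hkA.le, Real.sq_sqrt hkB.le]
  ring

/-- All wirings with `C` joined legs together amount to all configurations of `C` contractions. -/
theorem sum_wiringTerm (hb : C + b = nB) (ha : C + a = mA) (hkB : a + r = kB) (hkA : b + r = kA)
    (hN : mB + kB = N) (hB : nB + kB = L) (hA : mA + kA = L) (hM : nA + kA = M)
    (fA : Tens μ (Fin nA ⊕ Fin mA)) (fB : Tens μ (Fin nB ⊕ Fin mB)) (Ψ : FinFock μ) :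
    ((√(N.factorial) * √(M.factorial) / (kA.factorial * kB.factorial) : ℝ) : ℂ) •
      ∑ θ with (joined θ).card = C, wiringTerm hN hB hA hM fA fB ((Ψ : Fock μ) N) θ =
    ∑ π : {π : Fin C ↪ Fin nB // StrictAnti π}, ∑ π' : Fin C ↪ Fin mA, configSign π.1 π' •
      ((contribution π.1 π' fA fB Ψ : Fock μ) M : Tens μ (Fin M)) := by
  have hN' : a + mB + r = N := by omega
  have hM' : b + nA + r = M := by omega
  have hr : (r.factorial : ℂ) ≠ 0 := by exact_mod_cast r.factorial_ne_zero
  have hfA : (kA.factorial : ℂ) ≠ 0 := by exact_mod_cast kA.factorial_ne_zero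
  have hfB : (kB.factorial : ℂ) ≠ 0 := by exact_mod_cast kB.factorial_ne_zero
  have hterm : ∀ (π : Fin C ↪ Fin nB) (π' : Fin C ↪ Fin mA) (d : Fin a ⊕ Fin r ≃ Fin kB)
      (d' : Fin b ⊕ Fin r ≃ Fin kA), wiringTerm hN hB hA hM fA fB ((Ψ : Fock μ) N)
        (wiring (splitEnum π (card_uncontracted_of_add π hb))
          (splitEnum π' (card_uncontracted_of_add π' ha)) d d') =
      (configSign π π' : ℂ) • antisymm M (relabel (legs (b + nA) r hM') (contract
        (configKernel (splitEnum π (card_uncontracted_of_add π hb))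
          (splitEnum π' (card_uncontracted_of_add π' ha)) fA fB)
        (relabel (legs (a + mB) r hN').symm ((Ψ : Fock μ) N : Tens μ (Fin N))))) := by
    intro π π' d d'
    rw [wiringTerm, antisymm_contract_wiring hkB hkA hN hM hN' hM', smul_smul, ← Int.cast_mul,
      ← Units.val_mul, sign_wiring hb ha hkB hkA hB hA, ← crossing_eq, ← crossing_eq, mul_assoc,
      Int.units_mul_self, mul_one, configSign, show nB - C = b by omega, show mA - C = a by omega]
    norm_num
  have hcontr : ∀ (π : Fin C ↪ Fin nB) (π' : Fin C ↪ Fin mA),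
      ((contribution π π' fA fB Ψ : Fock μ) M : Tens μ (Fin M)) =
      ((√(N.factorial) * √(M.factorial) / r.factorial : ℝ) : ℂ) •
        antisymm M (relabel (legs (b + nA) r hM') (contract
        (configKernel (splitEnum π (card_uncontracted_of_add π hb))
          (splitEnum π' (card_uncontracted_of_add π' ha)) fA fB)
        (relabel (legs (a + mB) r hN').symm ((Ψ : Fock μ) N : Tens μ (Fin N))))) := by
    intro π π'
    rw [contribution_eq π π' (card_uncontracted_of_add π hb) (card_uncontracted_of_add π' ha),
      smear_apply hN' hM', smearSector_coe]
    congr 2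
    have hr : (0 : ℝ) < r.factorial := by exact_mod_cast r.factorial_pos
    rw [Real.sqrt_div' _ hr.le, Real.sqrt_div' _ hr.le, div_mul_div_comm, Real.mul_self_sqrt hr.le]
  have hfac := factorial_smul_sum_wirings hb ha hkB hkA
    (wiringTerm hN hB hA hM fA fB ((Ψ : Fock μ) N))
  simp only [hterm, Finset.sum_const, Finset.card_univ,
    Fintype.card_equiv (finSumFinEquiv.trans (finCongr hkB)),
    Fintype.card_equiv (finSumFinEquiv.trans (finCongr hkA)), Fintype.card_sum, Fintype.card_fin,
    hkA, hkB] at hfac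
  simp only [← Nat.cast_smul_eq_nsmul ℂ] at hfac
  -- the placements `d`, `d'` give the factor `kB! kA!`, to be compared after multiplying by `r!`
  refine smul_right_injective _ hr ?_
  simp only
  rw [smul_comm, hfac]
  simp only [hcontr, Finset.smul_sum, smul_smul, ← Int.cast_smul_eq_zsmul ℂ]
  refine Finset.sum_congr rfl fun π _ => Finset.sum_congr rfl fun π' _ => ?_
  congr 1
  push_cast
  field_simp

theorem card_joined_le {P Q R S : Type*} [Fintype P] [Fintype R] (θ : P ⊕ Q ≃ R ⊕ S) :
    (joined θ).card ≤ Fintype.card R := by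
  classical
  have := Finset.card_le_card_of_injOn (s := joined θ) (t := Finset.univ.map
    (Function.Embedding.inl : R ↪ R ⊕ S)) (fun j => θ (Sum.inl j))
    (fun j hj => by
      obtain ⟨i, hi⟩ := mem_joined.1 hj
      simp [hi])
    (fun i _ j _ h => Sum.inl_injective (θ.injective h))
  simpa using this

theorem card_le_card_joined_add {P Q R S : Type*} [Fintype P] [Fintype S] (θ : P ⊕ Q ≃ R ⊕ S) :
    Fintype.card P ≤ (joined θ).card + Fintype.card S := by
  classical
  have := Finset.card_le_card_of_injOn (s := (joined θ)ᶜ) (t := Finset.univ.map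
    (Function.Embedding.inr : S ↪ R ⊕ S)) (fun j => θ (Sum.inl j))
    (fun j hj => by
      rcases hx : θ (Sum.inl j) with y | x
      · exact absurd (mem_joined.2 ⟨y, hx⟩) (Finset.mem_compl.1 hj)
      · simp [hx])
    (fun i _ j _ h => Sum.inl_injective (θ.injective h))
  rw [Finset.card_compl, Finset.card_map, Finset.card_univ] at this
  omega

theorem contribution_apply_of_lt (π : Fin C ↪ Fin nB) (π' : Fin C ↪ Fin mA)
    (fA : Tens μ (Fin nA ⊕ Fin mA)) (fB : Tens μ (Fin nB ⊕ Fin mB)) (h : M < nB - C + nA)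
    (Ψ : FinFock μ) : (contribution π π' fA fB Ψ : Fock μ) M = 0 :=
  smear_apply_of_lt (by rwa [card_uncontracted]) _ Ψ

/-- The contraction formula on one sector, with the normal ordered product as the summand `C = 0`. -/
theorem smear_mul_smear_apply (fA : Tens μ (Fin nA ⊕ Fin mA)) (fB : Tens μ (Fin nB ⊕ Fin mB))
    (Ψ : FinFock μ) (M : ℕ) :
    (((smear nA mA fA * smear nB mB fB) Ψ : Fock μ) M : Tens μ (Fin M)) =
      ∑ C ∈ Finset.range (min mA nB + 1), ∑ π : {π : Fin C ↪ Fin nB // StrictAnti π},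
        ∑ π' : Fin C ↪ Fin mA, configSign π.1 π' •
          ((contribution π.1 π' fA fB Ψ : Fock μ) M : Tens μ (Fin M)) := by
  rw [Module.End.mul_apply]
  have hzero : ∀ (C : ℕ), M < nB - C + nA → ∑ π : {π : Fin C ↪ Fin nB // StrictAnti π},
      ∑ π' : Fin C ↪ Fin mA, configSign π.1 π' •
        ((contribution π.1 π' fA fB Ψ : Fock μ) M : Tens μ (Fin M)) = 0 := fun C h =>
    Finset.sum_eq_zero fun π _ => Finset.sum_eq_zero fun π' _ => by
      rw [contribution_apply_of_lt π.1 π' fA fB h, Submodule.coe_zero, smul_zero]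
  -- in a sector too small for `A` or for `B`, every configuration has too many creation legs
  by_cases hM : nA ≤ M
  swap
  · rw [smear_apply_of_lt (by omega), Finset.sum_eq_zero fun C _ => hzero C (by omega)]
    rfl
  obtain ⟨kA, hkA⟩ := Nat.exists_eq_add_of_le hM
  rw [smear_apply (rfl : mA + kA = _) hkA.symm]
  by_cases hL : nB ≤ mA + kA
  swap
  · rw [smear_apply_of_lt (by omega), map_zero, Finset.sum_eq_zero fun C hC => hzero C (by
      have := Finset.mem_range.1 hC
      omega)]
    rfl
  obtain ⟨kB, hkB⟩ := Nat.exists_eq_add_of_le hL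
  rw [smear_apply (rfl : mB + kB = _) hkB.symm, smearSector_smearSector,
    ← Finset.sum_fiberwise_of_maps_to (s := Finset.univ) (t := Finset.range (min mA nB + 1))
      (g := fun θ => (joined θ).card), Finset.smul_sum]
  swap
  · intro θ _
    have h1 := card_joined_le θ
    have h2 := (joined θ).card_le_univ
    simp only [Fintype.card_fin] at h1 h2
    simp only [Finset.mem_range]
    omega
  refine Finset.sum_congr rfl fun C hC => ?_
  have hC' := Finset.mem_range.1 hC
  by_cases hr : nB - C ≤ kA
  · obtain ⟨r, hr⟩ := Nat.exists_eq_add_of_le hr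
    exact sum_wiringTerm (b := nB - C) (a := mA - C) (r := r) (by omega) (by omega) (by omega)
      hr.symm _ _ _ _ fA fB Ψ
  -- the `nB - C` legs that are not joined need room among the `kA` particles that `A` leaves alone
  · rw [hzero C (by omega), Finset.sum_eq_zero, smul_zero]
    intro θ hθ
    have h := card_le_card_joined_add θ
    simp only [Finset.mem_filter, Finset.mem_univ, true_and] at hθ
    simp only [Fintype.card_fin] at h
    omega

end Product

end Friedrichs

theorem lemma2 {X : Type*} [MeasurableSpace X] (μ : MeasureTheory.Measure X)
    [MeasureTheory.SigmaFinite μ] (nA mA nB mB : ℕ)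
    (fA : Friedrichs.Tens μ (Fin nA ⊕ Fin mA)) (fB : Friedrichs.Tens μ (Fin nB ⊕ Fin mB)) :
    Friedrichs.smear nA mA fA * Friedrichs.smear nB mB fB =
      (-1 : ℤ) ^ (mA * nB) • Friedrichs.normalOrdered fA fB + Friedrichs.attached fA fB := by
  open Friedrichs in
  refine LinearMap.ext fun Ψ => finFock_ext fun M => Subtype.ext ?_
  -- taking a component is additive in the operator
  let ev : Module.End ℂ (FinFock μ) →+ Tens μ (Fin M) :=
    { toFun := fun T => ((T Ψ : Fock μ) M : Tens μ (Fin M))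
      map_zero' := rfl
      map_add' := fun _ _ => rfl }
  have h0 : ∑ π : {π : Fin 0 ↪ Fin nB // StrictAnti π}, ∑ π' : Fin 0 ↪ Fin mA,
      configSign π.1 π' • contribution π.1 π' fA fB =
      (-1 : ℤ) ^ (mA * nB) • normalOrdered fA fB := by
    have : Unique {π : Fin 0 ↪ Fin nB // StrictAnti π} :=
      { default := ⟨⟨Fin.elim0, fun i => i.elim0⟩, fun i => i.elim0⟩
        uniq := fun π => Subtype.ext (Function.Embedding.ext fun i => i.elim0) }
    rw [Fintype.sum_unique, Fintype.sum_unique, contribution_zero, configSign, crossing_zero,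
      crossing_zero]
    simp
  have hsplit : (-1 : ℤ) ^ (mA * nB) • normalOrdered fA fB + attached fA fB =
      ∑ C ∈ Finset.range (min mA nB + 1), ∑ π : {π : Fin C ↪ Fin nB // StrictAnti π},
        ∑ π' : Fin C ↪ Fin mA, configSign π.1 π' • contribution π.1 π' fA fB := by
    rw [← h0, attached, Finset.range_eq_Ico, Finset.sum_eq_sum_Ico_succ_bot (by omega)]
    rfl
  rw [hsplit, smear_mul_smear_apply]
  change _ = ev _
  simp only [map_sum, map_zsmul]
  rfl
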